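/- **SUCI5 (five-sub-step fifth-order scheme).** Consider the damped forced oscillator $\ddot u+2\xi\omega\dot u+\omega^2u=f(t)$. Put $\gamma_0=0$, $\gamma_5=1$ and let $\gamma_1,\gamma_2,\gamma_3,\gamma_4$ be real. One step of length $h>0$ of the scheme from $(t_n,u_n,\dot u_n)$ determines $(u_{n+\gamma_i},\dot u_{n+\gamma_i},\ddot u_{n+\gamma_i})$, $0\le i\le 5$, by $u_{n+\gamma_0}=u_n$, $\dot u_{n+\gamma_0}=\dot u_n$, the equations of motion $$\ddot u_{n+\gamma_i}+2\xi\omega\dot u_{n+\gamma_i}+\omega^2u_{n+\gamma_i}=f(t_n+\gamma_ih)\qquad(0\le i\le5),$$ and, for $1\le i\le 5$, $$u_{n+\gamma_i}=u_n+h\sum_{j=0}^i\alpha_{ij}\dot u_{n+\gamma_j},\qquad \dot u_{n+\gamma_i}=\dot u_n+h\sum_{j=0}^i\alpha_{ij}\ddot u_{n+\gamma_j};$$ $(u_{n+1},\dot u_{n+1})$ are the values for $i=5$. The coefficients are $\alpha_{10}=\gamma_1/2$, $\alpha_{ii}=\gamma_1/2$ $(1\le i\le5)$ and, with $$G(x)=30(1-x)(1-\gamma_2)\gamma_1^2+(50x-45+10(5-6x)\gamma_2)\gamma_1+5(4x-3)\gamma_2-15x+12,$$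 $$N=15\gamma_1^3\gamma_2-15\gamma_1^3-45\gamma_1^2\gamma_2+35\gamma_1^2+30\gamma_1\gamma_2-20\gamma_1-5\gamma_2+3,$$ $$\alpha_{54}=\frac{G(\gamma_3)}{60\gamma_4(\gamma_4-\gamma_3)(\gamma_4-\gamma_2)(\gamma_4-\gamma_1)},\qquad \alpha_{53}=\frac{G(\gamma_4)}{60\gamma_3(\gamma_3-\gamma_4)(\gamma_2-\gamma_3)(\gamma_1-\gamma_3)},$$ $$\alpha_{43}=\frac{\gamma_4(\gamma_4-\gamma_1)(\gamma_4-\gamma_2)(\gamma_4-\gamma_3)N}{\gamma_3(\gamma_3-\gamma_1)(\gamma_3-\gamma_2)G(\gamma_3)},$$ $$\alpha_{52}=\frac{3\gamma_1^2+6(\alpha_{53}\gamma_3+\alpha_{54}\gamma_4-1)\gamma_1-6\alpha_{53}\gamma_3^2-6\alpha_{54}\gamma_4^2+2}{6\gamma_2(\gamma_2-\gamma_1)},$$ $$\alpha_{32}=\frac{15\gamma_1^4-60\gamma_1^3+60\gamma_1^2-20\gamma_1+2}{120\alpha_{43}\alpha_{54}\gamma_2(\gamma_2-\gamma_1)},$$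 $$\alpha_{42}=\frac{P}{120\alpha_{43}\alpha_{54}^2\gamma_2(\gamma_1-\gamma_2)},$$ where $$\begin{aligned}P={}&15\alpha_{53}\gamma_1^4+30(\alpha_{43}\alpha_{54}-2\alpha_{53})\gamma_1^3+30(2\alpha_{53}-3\alpha_{43}\alpha_{54})\gamma_1^2\\&+20(-6\alpha_{43}^2\alpha_{54}^2\gamma_3+3\alpha_{43}\alpha_{54}-\alpha_{53})\gamma_1+120\alpha_{43}^2\alpha_{54}^2\gamma_3^2-10\alpha_{43}\alpha_{54}+2\alpha_{53},\end{aligned}$$ $$\alpha_{20}=\frac{-\gamma_1^2+3\gamma_1\gamma_2-\gamma_2^2}{2\gamma_1},\qquad \alpha_{21}=\frac{\gamma_2(\gamma_2-\gamma_1)}{2\gamma_1},$$ $$\alpha_{30}=\frac{-\gamma_1^2+(3\gamma_3-2\alpha_{32})\gamma_1+2\alpha_{32}\gamma_2-\gamma_3^2}{2\gamma_1},\qquad \alpha_{31}=\frac{-2\alpha_{32}\gamma_2-\gamma_1\gamma_3+\gamma_3^2}{2\gamma_1},$$ $$\alpha_{40}=\frac{-\gamma_1^2+(3\gamma_4-2\alpha_{42}-2\alpha_{43})\gamma_1+2\alpha_{42}\gamma_2+2\alpha_{43}\gamma_3-\gamma_4^2}{2\gamma_1},\qquad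 \alpha_{41}=\frac{-2\alpha_{42}\gamma_2-2\alpha_{43}\gamma_3-\gamma_1\gamma_4+\gamma_4^2}{2\gamma_1},$$ $$\alpha_{50}=\frac{-\gamma_1^2+(3-2\alpha_{52}-2\alpha_{53}-2\alpha_{54})\gamma_1+2\alpha_{52}\gamma_2+2\alpha_{53}\gamma_3+2\alpha_{54}\gamma_4-1}{2\gamma_1},$$ $$\alpha_{51}=\frac{-2\alpha_{52}\gamma_2-2\alpha_{53}\gamma_3-2\alpha_{54}\gamma_4-\gamma_1+1}{2\gamma_1}.$$ Let $\gamma_1,\dots,\gamma_4$ be nonzero and pairwise distinct with $G(\gamma_3)\ne0$ and $N\ne0$ (so that no denominator vanishes), and otherwise arbitrary. Let $A=(\alpha_{ij})_{0\le i,j\le5}$ (with $\alpha_{ij}=0$ for $j>i$ and $\alpha_{00}=0$), let $b^{T}=(\alpha_{50},\dots,\alpha_{55})$ be its last row, let $\mathbf 1$ and $\mathbf 0$ be the constant columns, and set $$S=\begin{bmatrix}2\xi\omega I+\omega^2hA&I\\I&-hA\end{bmatrix},\qquad B=\begin{bmatrix}h\,b^T&\mathbf 0^T\\ \mathbf 0^T&h\,b^T\end{bmatrix},\qquad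 D_{num}=I_2+B\,S^{-1}\begin{bmatrix}-\omega^2\mathbf 1&\mathbf 0\\ \mathbf 0&\mathbf 1\end{bmatrix},\qquad L_{num}=B\,S^{-1}\begin{bmatrix}(e^{\gamma_ih})_{0\le i\le5}\\ \mathbf 0\end{bmatrix}.$$ Then the following hold. 1. *(Fifth-order accuracy, local errors.)* For all real $\xi,\omega,t_n$, every $f\in C^5(\mathbb R)$ and every solution $u$ of $\ddot u+2\xi\omega\dot u+\omega^2u=f$ on $\mathbb R$: for all sufficiently small $h>0$ the step from $(t_n,u(t_n),\dot u(t_n))$ has exactly one solution, and $u_{n+1}-u(t_n+h)=\mathcal O(h^6)$ and $\dot u_{n+1}-\dot u(t_n+h)=\mathcal O(h^6)$ as $h\to0^+$. 2. *(Fifth-order accuracy, amplification matrix and load operator.)* For all $0\le\xi<1$ and $\omega>0$, the matrix $S$ is invertible for all sufficiently small $h>0$, and, entrywise as $h\to0^+$, $D_{num}-D_{exa}=\mathcal O(h^6)$ and $L_{num}-L_{exa}=\mathcal O(h^6)$, where, with $\omega_d=\sqrt{1-\xi^2}\,\omega$ and $q=\omega^2+2\xi\omega+1$, $$D_{exa}=e^{-\xi\omega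 h}\begin{bmatrix}\cos(\omega_dh)+\frac{\xi\omega}{\omega_d}\sin(\omega_dh)&\frac1{\omega_d}\sin(\omega_dh)\\-\frac{\omega^2}{\omega_d}\sin(\omega_dh)&\cos(\omega_dh)-\frac{\xi\omega}{\omega_d}\sin(\omega_dh)\end{bmatrix},$$ $$L_{exa}=\begin{bmatrix}\frac{e^{h}}{q}-e^{-\xi\omega h}\,\frac{\omega_d\cos(\omega_dh)+(1+\xi\omega)\sin(\omega_dh)}{\omega_dq}\\[4pt]\frac{e^{h}}{q}+e^{-\xi\omega h}\,\frac{(\omega^2+\xi\omega)\sin(\omega_dh)-\omega_d\cos(\omega_dh)}{\omega_dq}\end{bmatrix}$$ are the exact amplification matrix and the exact load operator for the load $f(t)=e^t$ on $[0,h]$. 3. *(High-frequency limit.)* For all real $\xi$, all $h>0$ and all real $\rho_\infty$: $S$ is invertible for all sufficiently large $\omega$ and the characteristic polynomial of $D_{num}$ tends coefficientwise to $(\zeta-\rho_\infty)^2$ as $\omega\to\infty$ if and only if $$\frac{15\gamma_1^5-150\gamma_1^4+300\gamma_1^3-200\gamma_1^2+50\gamma_1-4}{15\gamma_1^5}=\rho_\infty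 .$$ In particular this quotient is the double eigenvalue in the high-frequency limit. -/

import Mathlib

open Filter Topology Asymptotics

noncomputable section

namespace SubStep

/-! ## Composite `s`-sub-step schemes for `u'' + 2 ξ ω u' + ω² u = f`

A scheme is given by splitting ratios `c 0, …, c s` (with `c 0 = 0` and `c s = 1`) and a lower
triangular coefficient matrix `A = (α i j)`, `0 ≤ i, j ≤ s`, whose row `0` vanishes. -/

/-- The stage values `U i`, `V i`, `W i` (displacement, velocity, acceleration at `tn + c i * h`)
of one step of length `h` that starts at time `tn` from displacement `un` and velocity `vn`.
As `A` is lower triangular, the sums run over `j ≤ i`.  The new displacement and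
velocity are those of the last sub-step. -/
structure IsStep {s : ℕ} (A : Matrix (Fin (s + 1)) (Fin (s + 1)) ℝ) (c : Fin (s + 1) → ℝ)
    (ξ ω : ℝ) (f : ℝ → ℝ) (tn h un vn : ℝ) (U V W : Fin (s + 1) → ℝ) : Prop where
  start_disp : U 0 = un
  start_vel : V 0 = vn
  equilibrium : ∀ i, W i + 2 * ξ * ω * V i + ω ^ 2 * U i = f (tn + c i * h)
  disp : ∀ i, i ≠ 0 → U i = un + h * ∑ j, A i j * V j
  vel : ∀ i, i ≠ 0 → V i = vn + h * ∑ j, A i j * W j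

/-- The coefficient matrix of the linear system for the stage velocities and accelerations. -/
def stageMatrix {s : ℕ} (A : Matrix (Fin (s + 1)) (Fin (s + 1)) ℝ) (ξ ω h : ℝ) :
    Matrix (Fin (s + 1) ⊕ Fin (s + 1)) (Fin (s + 1) ⊕ Fin (s + 1)) ℝ :=
  Matrix.fromBlocks ((2 * ξ * ω) • 1 + (ω ^ 2 * h) • A) 1 1 (-(h • A))

/-- The block matrix `[h bᵀ, 0; 0, h bᵀ]`, where `b` is the last row of `A`. -/
def updateMatrix {s : ℕ} (A : Matrix (Fin (s + 1)) (Fin (s + 1)) ℝ) (h : ℝ) :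
    Matrix (Fin 2) (Fin (s + 1) ⊕ Fin (s + 1)) ℝ :=
  Matrix.of ![Sum.elim (fun j => h * A (Fin.last s) j) (fun _ => 0),
    Sum.elim (fun _ => 0) (fun j => h * A (Fin.last s) j)]

/-- The block matrix `[-ω² 1, 0; 0, 1]`, where `1` is the column of ones. -/
def initialMatrix (s : ℕ) (ω : ℝ) : Matrix (Fin (s + 1) ⊕ Fin (s + 1)) (Fin 2) ℝ :=
  Matrix.of (Sum.elim (fun _ => ![-ω ^ 2, 0]) (fun _ => ![0, 1]))

/-- The numerical amplification matrix. -/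
def Dnum {s : ℕ} (A : Matrix (Fin (s + 1)) (Fin (s + 1)) ℝ) (ξ ω h : ℝ) :
    Matrix (Fin 2) (Fin 2) ℝ :=
  1 + updateMatrix A h * (stageMatrix A ξ ω h)⁻¹ * initialMatrix s ω

/-- The numerical load operator, for the load `exp` and a step from `0` to `h`. -/
def Lnum {s : ℕ} (A : Matrix (Fin (s + 1)) (Fin (s + 1)) ℝ) (c : Fin (s + 1) → ℝ)
    (ξ ω h : ℝ) : Fin 2 → ℝ :=
  (updateMatrix A h * (stageMatrix A ξ ω h)⁻¹).mulVec
    (Sum.elim (fun i => Real.exp (c i * h)) (fun _ => 0))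

/-- The damped frequency. -/
def dampedFreq (ξ ω : ℝ) : ℝ := Real.sqrt (1 - ξ ^ 2) * ω

/-- The exact amplification matrix (for `0 ≤ ξ < 1`, `0 < ω`). -/
def Dexa (ξ ω h : ℝ) : Matrix (Fin 2) (Fin 2) ℝ :=
  let wd := dampedFreq ξ ω
  Real.exp (-ξ * ω * h) •
    !![Real.cos (wd * h) + ξ * ω / wd * Real.sin (wd * h), 1 / wd * Real.sin (wd * h);
       -(ω ^ 2 / wd) * Real.sin (wd * h), -(ξ * ω / wd) * Real.sin (wd * h) + Real.cos (wd * h)]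

/-- The exact load operator for the load `exp` (for `0 ≤ ξ < 1`, `0 < ω`). -/
def Lexa (ξ ω h : ℝ) : Fin 2 → ℝ :=
  let wd := dampedFreq ξ ω
  let q := ω ^ 2 + 2 * ξ * ω + 1
  ![Real.exp h / q - Real.exp (-ξ * ω * h) *
      ((wd * Real.cos (wd * h) + (1 + ξ * ω) * Real.sin (wd * h)) / (wd * q)),
    Real.exp h / q + Real.exp (-ξ * ω * h) *
      (((ω ^ 2 + ξ * ω) * Real.sin (wd * h) - wd * Real.cos (wd * h)) / (wd * q))]

/-- Accuracy of order `p`, in terms of the amplification matrices and the load operators: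
`Dnum - Dexa = O(h ^ (p + 1))` and `Lnum - Lexa = O(h ^ (p + 1))` as `h → 0+`. -/
def OperatorAccurate {s : ℕ} (p : ℕ) (A : Matrix (Fin (s + 1)) (Fin (s + 1)) ℝ)
    (c : Fin (s + 1) → ℝ) : Prop :=
  ∀ ξ ω : ℝ, 0 ≤ ξ → ξ < 1 → 0 < ω →
    (∀ᶠ h in 𝓝[>] (0 : ℝ), IsUnit (stageMatrix A ξ ω h)) ∧
    (∀ i j, (fun h : ℝ => Dnum A ξ ω h i j - Dexa ξ ω h i j)
      =O[𝓝[>] (0 : ℝ)] fun h => h ^ (p + 1)) ∧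
    (∀ i, (fun h : ℝ => Lnum A c ξ ω h i - Lexa ξ ω h i)
      =O[𝓝[>] (0 : ℝ)] fun h => h ^ (p + 1))

/-- Accuracy of order `p`, in terms of the local errors in displacement and velocity, for every
damping ratio, frequency, load of class `C^p` and solution `u` (with velocity `v`). -/
def LocallyAccurate {s : ℕ} (p : ℕ) (A : Matrix (Fin (s + 1)) (Fin (s + 1)) ℝ)
    (c : Fin (s + 1) → ℝ) : Prop :=
  ∀ (ξ ω : ℝ) (f u v : ℝ → ℝ), ContDiff ℝ p f →
    (∀ t, HasDerivAt u (v t) t) →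
    (∀ t, HasDerivAt v (f t - 2 * ξ * ω * v t - ω ^ 2 * u t) t) →
    ∀ tn : ℝ,
      (∀ᶠ h in 𝓝[>] (0 : ℝ), ∃! Y : (Fin (s + 1) → ℝ) × (Fin (s + 1) → ℝ) × (Fin (s + 1) → ℝ),
        IsStep A c ξ ω f tn h (u tn) (v tn) Y.1 Y.2.1 Y.2.2) ∧
      ∀ U V W : ℝ → Fin (s + 1) → ℝ,
        (∀ᶠ h in 𝓝[>] (0 : ℝ), IsStep A c ξ ω f tn h (u tn) (v tn) (U h) (V h) (W h)) →
        ((fun h : ℝ => U h (Fin.last s) - u (tn + h)) =O[𝓝[>] (0 : ℝ)] fun h => h ^ (p + 1)) ∧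
        ((fun h : ℝ => V h (Fin.last s) - v (tn + h)) =O[𝓝[>] (0 : ℝ)] fun h => h ^ (p + 1))

/-- In the high-frequency limit `ω → ∞` (with `ξ` and `h` fixed) the numerical amplification
matrix is well defined and its characteristic polynomial tends, coefficient by
coefficient, to `(X - r) ^ 2`. -/
def HasHighFreqDoubleEigenvalue {s : ℕ} (A : Matrix (Fin (s + 1)) (Fin (s + 1)) ℝ)
    (ξ h r : ℝ) : Prop :=
  (∀ᶠ ω in atTop, IsUnit (stageMatrix A ξ ω h)) ∧
  ∀ k : ℕ, Tendsto (fun ω : ℝ => (Dnum A ξ ω h).charpoly.coeff k) atTop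
    (𝓝 (((Polynomial.X - Polynomial.C r) ^ 2).coeff k))

end SubStep

namespace SUCI5

/-! ## The coefficients of the five-sub-step scheme -/

def G (g1 g2 x : ℝ) : ℝ :=
  30 * (1 - x) * (1 - g2) * g1 ^ 2 + (50 * x - 45 + 10 * (5 - 6 * x) * g2) * g1
    + 5 * (4 * x - 3) * g2 - 15 * x + 12

/-- The last factor in the numerator of `α43`. -/
def N (g1 g2 : ℝ) : ℝ :=
  15 * g1 ^ 3 * g2 - 15 * g1 ^ 3 - 45 * g1 ^ 2 * g2 + 35 * g1 ^ 2 + 30 * g1 * g2 - 20 * g1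
    - 5 * g2 + 3

def a54 (g1 g2 g3 g4 : ℝ) : ℝ :=
  G g1 g2 g3 / (60 * g4 * (g4 - g3) * (g4 - g2) * (g4 - g1))

def a53 (g1 g2 g3 g4 : ℝ) : ℝ :=
  G g1 g2 g4 / (60 * g3 * (g3 - g4) * (g2 - g3) * (g1 - g3))

def a43 (g1 g2 g3 g4 : ℝ) : ℝ :=
  g4 * (g4 - g1) * (g4 - g2) * (g4 - g3) * N g1 g2 /
    (g3 * (g3 - g1) * (g3 - g2) * G g1 g2 g3)

def a52 (g1 g2 g3 g4 : ℝ) : ℝ :=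
  let a53 := a53 g1 g2 g3 g4
  let a54 := a54 g1 g2 g3 g4
  (3 * g1 ^ 2 + 6 * (a53 * g3 + a54 * g4 - 1) * g1 - 6 * a53 * g3 ^ 2 - 6 * a54 * g4 ^ 2 + 2) /
    (6 * g2 * (g2 - g1))

def a42 (g1 g2 g3 g4 : ℝ) : ℝ :=
  let a43 := a43 g1 g2 g3 g4
  let a53 := a53 g1 g2 g3 g4
  let a54 := a54 g1 g2 g3 g4
  (15 * a53 * g1 ^ 4 + 30 * (a43 * a54 - 2 * a53) * g1 ^ 3
      + 30 * (2 * a53 - 3 * a43 * a54) * g1 ^ 2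
      + 20 * (-6 * a43 ^ 2 * a54 ^ 2 * g3 + 3 * a43 * a54 - a53) * g1
      + 120 * a43 ^ 2 * a54 ^ 2 * g3 ^ 2 - 10 * a43 * a54 + 2 * a53) /
    (120 * a43 * a54 ^ 2 * g2 * (g1 - g2))

def a32 (g1 g2 g3 g4 : ℝ) : ℝ :=
  (15 * g1 ^ 4 - 60 * g1 ^ 3 + 60 * g1 ^ 2 - 20 * g1 + 2) /
    (120 * a43 g1 g2 g3 g4 * a54 g1 g2 g3 g4 * g2 * (g2 - g1))

def a20 (g1 g2 : ℝ) : ℝ := (-g1 ^ 2 + 3 * g1 * g2 - g2 ^ 2) / (2 * g1)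

def a21 (g1 g2 : ℝ) : ℝ := g2 * (g2 - g1) / (2 * g1)

def a30 (g1 g2 g3 g4 : ℝ) : ℝ :=
  let a32 := a32 g1 g2 g3 g4
  (-g1 ^ 2 + (3 * g3 - 2 * a32) * g1 + 2 * a32 * g2 - g3 ^ 2) / (2 * g1)

def a31 (g1 g2 g3 g4 : ℝ) : ℝ :=
  (-2 * a32 g1 g2 g3 g4 * g2 - g1 * g3 + g3 ^ 2) / (2 * g1)

def a40 (g1 g2 g3 g4 : ℝ) : ℝ :=
  let a42 := a42 g1 g2 g3 g4
  let a43 := a43 g1 g2 g3 g4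
  (-g1 ^ 2 + (3 * g4 - 2 * a42 - 2 * a43) * g1 + 2 * a42 * g2 + 2 * a43 * g3 - g4 ^ 2) / (2 * g1)

def a41 (g1 g2 g3 g4 : ℝ) : ℝ :=
  (-2 * a42 g1 g2 g3 g4 * g2 - 2 * a43 g1 g2 g3 g4 * g3 - g1 * g4 + g4 ^ 2) / (2 * g1)

def a50 (g1 g2 g3 g4 : ℝ) : ℝ :=
  let a52 := a52 g1 g2 g3 g4
  let a53 := a53 g1 g2 g3 g4
  let a54 := a54 g1 g2 g3 g4
  (-g1 ^ 2 + (3 - 2 * a52 - 2 * a53 - 2 * a54) * g1 + 2 * a52 * g2 + 2 * a53 * g3 + 2 * a54 * g4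
    - 1) / (2 * g1)

def a51 (g1 g2 g3 g4 : ℝ) : ℝ :=
  (-2 * a52 g1 g2 g3 g4 * g2 - 2 * a53 g1 g2 g3 g4 * g3 - 2 * a54 g1 g2 g3 g4 * g4 - g1 + 1) /
    (2 * g1)

/-- The matrix `(α i j)`, `0 ≤ i, j ≤ 5`; its first sub-step is the trapezoidal rule. -/
def A (g1 g2 g3 g4 : ℝ) : Matrix (Fin 6) (Fin 6) ℝ :=
  !![0, 0, 0, 0, 0, 0;
     g1 / 2, g1 / 2, 0, 0, 0, 0;
     a20 g1 g2, a21 g1 g2, g1 / 2, 0, 0, 0;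
     a30 g1 g2 g3 g4, a31 g1 g2 g3 g4, a32 g1 g2 g3 g4, g1 / 2, 0, 0;
     a40 g1 g2 g3 g4, a41 g1 g2 g3 g4, a42 g1 g2 g3 g4, a43 g1 g2 g3 g4, g1 / 2, 0;
     a50 g1 g2 g3 g4, a51 g1 g2 g3 g4, a52 g1 g2 g3 g4, a53 g1 g2 g3 g4, a54 g1 g2 g3 g4, g1 / 2]

/-- The splitting ratios `γ 0 = 0, γ 1, …, γ 4, γ 5 = 1`. -/
def nodes (g1 g2 g3 g4 : ℝ) : Fin 6 → ℝ := ![0, g1, g2, g3, g4, 1]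

/-- All denominators in the definition of the coefficients are nonzero. -/
structure Admissible (g1 g2 g3 g4 : ℝ) : Prop where
  g1_ne : g1 ≠ 0
  g2_ne : g2 ≠ 0
  g3_ne : g3 ≠ 0
  g4_ne : g4 ≠ 0
  g12 : g1 ≠ g2
  g13 : g1 ≠ g3
  g14 : g1 ≠ g4
  g23 : g2 ≠ g3
  g24 : g2 ≠ g4
  g34 : g3 ≠ g4
  G_ne : G g1 g2 g3 ≠ 0
  N_ne : N g1 g2 ≠ 0

/-- The high-frequency double eigenvalue. -/
def rhoInf (g1 : ℝ) : ℝ :=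
  (15 * g1 ^ 5 - 150 * g1 ^ 4 + 300 * g1 ^ 3 - 200 * g1 ^ 2 + 50 * g1 - 4) / (15 * g1 ^ 5)

end SUCI5

end

/-! The oscillator is linear, so fifth order needs only conditions on `A` and its powers applied to
powers of the nodes `c`; they are collected in `OrderFive`. Inserting an exact solution into the
stage formulas leaves defects `d = g(t + c h) - g(t) - h A g'(t + c h)`, and the stage errors
satisfy `eU = h A eV - dU`, `eV = h A eW - dV`, where `eW` is a linear combination of `eU` and `eV`.
Stage order two makes `d`, hence all stage errors, `O(h^3)` (`stage_errors_isBigO`). The remaining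
conditions make the last entries of `d`, `A d`, `A² d` of sizes `h^6`, `h^5`, `h^4`. Unrolling the
recursion from `A² e` to `A e` to `e` then gains one power of `h` at a time in the last entry
(`OrderFive.locallyAccurate`).

The operator statement is the local one applied to particular solutions: the columns of `Dexa` solve
the unloaded equation with initial data the unit vectors, and `Lexa` solves the equation with load
`exp` from rest.

For `ω → ∞` the matrix `A` decides alone. Its row 0 vanishes and its other diagonal entries equal `g
= γ1/2 ≠ 0`, so its kernel is a line, spanned by some `r` with `r 0 = 1`. Once displacements are
multiplied by `ω`, the stages converge to multiples of `r`; thus `D_num` is similar, by `diag(ω,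
1)`, to a matrix tending to `r_last • 1`. By Cayley–Hamilton `A (A - g)^5 = 0`, so `r = (-g)⁻⁵ (A -
g)^5 1`, and the order conditions, through `(A^m 1)_last = 1/m!` for `m ≤ 5`, evaluate `r_last`. A
double eigenvalue is determined by the linear coefficient of its polynomial, which gives the
equivalence.

It remains to verify `OrderFive` for the given coefficients. Testing the conditions on polynomials
that vanish at the first few nodes isolates the coefficients and explains `G` and `N`. -/

noncomputable section

namespace SubStep

open Matrix

variable {s : ℕ} {A : Matrix (Fin (s + 1)) (Fin (s + 1)) ℝ} {c : Fin (s + 1) → ℝ}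

section Step

/-! ### The linear system of one step -/

variable {ξ ω tn h un vn : ℝ} {f : ℝ → ℝ} {U V W : Fin (s + 1) → ℝ}

theorem stageMatrix_mulVec_elim (A : Matrix (Fin (s + 1)) (Fin (s + 1)) ℝ) (ξ ω h : ℝ)
    (V W : Fin (s + 1) → ℝ) :
    stageMatrix A ξ ω h *ᵥ Sum.elim V W =
      Sum.elim ((2 * ξ * ω) • V + (ω ^ 2 * h) • A *ᵥ V + W) (V - h • A *ᵥ W) := by
  rw [stageMatrix, Matrix.fromBlocks_mulVec]
  simp [Matrix.add_mulVec, Matrix.smul_mulVec, Matrix.neg_mulVec, sub_eq_add_neg]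

/-- If row `0` of the coefficient matrix vanishes, the step equations are the linear system of the
stage matrix, together with the formula for the stage displacements. -/
theorem isStep_iff (hA : ∀ j, A 0 j = 0) :
    IsStep A c ξ ω f tn h un vn U V W ↔
      stageMatrix A ξ ω h *ᵥ Sum.elim V W =
        Sum.elim (fun i => f (tn + c i * h) - ω ^ 2 * un) (fun _ => vn) ∧
      U = fun i => un + h * (A *ᵥ V) i := by
  have hrow : ∀ X : Fin (s + 1) → ℝ, (A *ᵥ X) 0 = 0 := fun X => by
    simp [Matrix.mulVec, dotProduct, hA]
  rw [stageMatrix_mulVec_elim]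
  constructor
  · intro H
    have hU : ∀ i, U i = un + h * (A *ᵥ V) i := by
      intro i
      by_cases hi : i = 0
      · subst hi; rw [H.start_disp, hrow]; ring
      · exact H.disp i hi
    have hV : ∀ i, V i = vn + h * (A *ᵥ W) i := by
      intro i
      by_cases hi : i = 0
      · subst hi; rw [H.start_vel, hrow]; ring
      · exact H.vel i hi
    refine ⟨?_, funext hU⟩
    congr 1
    · funext i
      have := H.equilibrium i
      rw [hU i] at this
      simp only [Pi.add_apply, Pi.smul_apply, smul_eq_mul]
      linear_combination this
    · funext i
      simp only [Pi.sub_apply, Pi.smul_apply, smul_eq_mul]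
      linear_combination hV i
  · rintro ⟨hS, hU⟩
    have h1 : ∀ i, 2 * ξ * ω * V i + ω ^ 2 * h * (A *ᵥ V) i + W i =
        f (tn + c i * h) - ω ^ 2 * un := fun i => by
      simpa using congrFun hS (Sum.inl i)
    have h2 : ∀ i, V i - h * (A *ᵥ W) i = vn := fun i => by
      simpa using congrFun hS (Sum.inr i)
    refine ⟨?_, ?_, ?_, ?_, ?_⟩
    · rw [hU]; simp [hrow]
    · have := h2 0
      rw [hrow] at this
      linear_combination this
    · intro i
      rw [hU]
      linear_combination h1 i
    · intro i _
      rw [hU]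
      rfl
    · intro i _
      change V i = vn + h * (A *ᵥ W) i
      linear_combination h2 i

theorem existsUnique_isStep (hA : ∀ j, A 0 j = 0) (hS : IsUnit (stageMatrix A ξ ω h)) :
    ∃! Y : (Fin (s + 1) → ℝ) × (Fin (s + 1) → ℝ) × (Fin (s + 1) → ℝ),
      IsStep A c ξ ω f tn h un vn Y.1 Y.2.1 Y.2.2 := by
  have hdet := (Matrix.isUnit_iff_isUnit_det _).1 hS
  set R : Fin (s + 1) ⊕ Fin (s + 1) → ℝ :=
    Sum.elim (fun i => f (tn + c i * h) - ω ^ 2 * un) (fun _ => vn) with hR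
  set X := (stageMatrix A ξ ω h)⁻¹ *ᵥ R with hX
  have hXe : Sum.elim (X ∘ Sum.inl) (X ∘ Sum.inr) = X := Sum.elim_comp_inl_inr X
  refine ⟨(fun i => un + h * (A *ᵥ (X ∘ Sum.inl)) i, X ∘ Sum.inl, X ∘ Sum.inr), ?_, ?_⟩
  · refine (isStep_iff hA).2 ⟨?_, rfl⟩
    simp only [hXe]
    rw [hX, Matrix.mulVec_mulVec, Matrix.mul_nonsing_inv _ hdet, Matrix.one_mulVec]
  · rintro ⟨U, V, W⟩ H
    obtain ⟨h1, h2⟩ := (isStep_iff hA).1 H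
    have hVW : Sum.elim V W = X := by
      rw [hX, hR, ← h1, Matrix.mulVec_mulVec, Matrix.nonsing_inv_mul _ hdet, Matrix.one_mulVec]
    have hV : V = X ∘ Sum.inl := by rw [← hVW]; rfl
    have hW : W = X ∘ Sum.inr := by rw [← hVW]; rfl
    dsimp only at h2
    rw [h2, hV, hW]

/-- The stage matrix is invertible for all small step lengths. -/
theorem eventually_isUnit_stageMatrix (A : Matrix (Fin (s + 1)) (Fin (s + 1)) ℝ) (ξ ω : ℝ) :
    ∀ᶠ h in 𝓝 (0 : ℝ), IsUnit (stageMatrix A ξ ω h) := by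
  have hcont : Continuous fun h : ℝ => (stageMatrix A ξ ω h).det := by
    refine Continuous.matrix_det ?_
    unfold stageMatrix
    refine Continuous.matrix_fromBlocks ?_ continuous_const continuous_const ?_ <;> fun_prop
  -- At `h = 0` the matrix is `[2ξω I, I; I, 0]`, and its determinant depends continuously on `h`.
  have h0 : (stageMatrix A ξ ω 0).det ≠ 0 := by
    refine ((Matrix.isUnit_iff_isUnit_det _).1 ?_).ne_zero
    rw [← Matrix.mulVec_injective_iff_isUnit]
    refine (injective_iff_map_eq_zero (Matrix.mulVecLin (stageMatrix A ξ ω 0))).2 fun X hX => ?_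
    have hX' : stageMatrix A ξ ω 0 *ᵥ Sum.elim (X ∘ Sum.inl) (X ∘ Sum.inr) = 0 := by
      rw [Sum.elim_comp_inl_inr]; exact hX
    rw [stageMatrix_mulVec_elim] at hX'
    have h2 : ∀ i, X (Sum.inl i) = 0 := fun i => by simpa using congrFun hX' (Sum.inr i)
    have h1 : ∀ i, X (Sum.inr i) = 0 := fun i => by
      have h3 : X ∘ Sum.inl = 0 := funext h2
      simpa [h2, h3] using congrFun hX' (Sum.inl i)
    funext i
    rcases i with i | i
    exacts [h2 i, h1 i]
  filter_upwards [hcont.continuousAt.eventually_ne h0] with h hh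
  exact (Matrix.isUnit_iff_isUnit_det _).2 (isUnit_iff_ne_zero.2 hh)

/-- The result of a step in terms of the amplification matrix. -/
theorem IsStep.end_eq (hA : ∀ j, A 0 j = 0) (hS : IsUnit (stageMatrix A ξ ω h))
    (H : IsStep A c ξ ω f tn h un vn U V W) :
    ![U (Fin.last s), V (Fin.last s)] = Dnum A ξ ω h *ᵥ ![un, vn] +
      (updateMatrix A h * (stageMatrix A ξ ω h)⁻¹) *ᵥ
        Sum.elim (fun i => f (tn + c i * h)) (fun _ => 0) := by
  have hdet := (Matrix.isUnit_iff_isUnit_det _).1 hS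
  obtain ⟨h1, h2⟩ := (isStep_iff hA).1 H
  have hR : Sum.elim (fun i => f (tn + c i * h) - ω ^ 2 * un) (fun _ => vn) =
      initialMatrix s ω *ᵥ ![un, vn] + Sum.elim (fun i => f (tn + c i * h)) (fun _ => 0) := by
    funext i
    rcases i with i | i
    · simp [initialMatrix]; ring
    · simp [initialMatrix]
  have hX : Sum.elim V W = (stageMatrix A ξ ω h)⁻¹ *ᵥ (initialMatrix s ω *ᵥ ![un, vn]) +
      (stageMatrix A ξ ω h)⁻¹ *ᵥ Sum.elim (fun i => f (tn + c i * h)) (fun _ => 0) := by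
    rw [← Matrix.mulVec_add, ← hR, ← h1, Matrix.mulVec_mulVec, Matrix.nonsing_inv_mul _ hdet,
      Matrix.one_mulVec]
  have hV : V (Fin.last s) = vn + h * (A *ᵥ W) (Fin.last s) := by
    have := congrFun h1 (Sum.inr (Fin.last s))
    rw [stageMatrix_mulVec_elim] at this
    simp at this
    linear_combination this
  have hU : U (Fin.last s) = un + h * (A *ᵥ V) (Fin.last s) := congrFun h2 _
  have hB : updateMatrix A h *ᵥ Sum.elim V W =
      ![h * (A *ᵥ V) (Fin.last s), h * (A *ᵥ W) (Fin.last s)] := by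
    funext i
    fin_cases i
    · simp [updateMatrix, Matrix.mulVec, dotProduct, Finset.mul_sum, mul_assoc]
    · simp [updateMatrix, Matrix.mulVec, dotProduct, Finset.mul_sum, mul_assoc]
  have hD : ![U (Fin.last s), V (Fin.last s)] =
      ![un, vn] + updateMatrix A h *ᵥ Sum.elim V W := by
    rw [hB, hU, hV]
    simp
  rw [hD, hX, Dnum, Matrix.add_mulVec, Matrix.one_mulVec, Matrix.mulVec_add]
  simp only [Matrix.mulVec_mulVec, Matrix.mul_assoc, add_assoc]

end Step

/-! ### Taylor expansion of the quadrature defects -/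

/-- Peano's remainder needs no derivative beyond order `n`; the term of degree `n` is itself
`O(h^n)` and is dropped from the sum. This is why a load of class `C^5` suffices. -/
theorem taylor_isBigO {g : ℝ → ℝ} {n : ℕ} (hg : ContDiff ℝ n g) (t a : ℝ) :
    (fun h : ℝ => g (t + a * h) -
      ∑ k ∈ Finset.range n, iteratedDeriv k g t / k.factorial * (a * h) ^ k)
      =O[𝓝 0] fun h => h ^ n := by
  have h1 := (taylor_isLittleO_univ (x₀ := t) hg).isBigO
  have ht : Tendsto (fun h : ℝ => t + a * h) (𝓝 0) (𝓝 t) := by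
    have : Continuous fun h : ℝ => t + a * h := by fun_prop
    simpa using this.tendsto 0
  have h2 := h1.comp_tendsto ht
  have h3 : (fun h : ℝ => (a * h) ^ n) =O[𝓝 0] fun h => h ^ n :=
    IsBigO.of_bound (|a| ^ n) (Eventually.of_forall fun h => by simp [mul_pow])
  have h4 : (fun h : ℝ => g (t + a * h) -
      ∑ k ∈ Finset.range (n + 1), iteratedDeriv k g t / k.factorial * (a * h) ^ k)
      =O[𝓝 0] fun h => h ^ n := by
    refine IsBigO.trans (IsBigO.congr h2 (fun h => ?_) (fun h => ?_)) h3
    · simp only [Function.comp, taylor_within_apply, iteratedDerivWithin_univ, smul_eq_mul,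
        add_sub_cancel_left]
      congr 1
      exact Finset.sum_congr rfl fun k _ => by ring
    · simp
  have h5 : (fun h : ℝ => iteratedDeriv n g t / n.factorial * (a * h) ^ n)
      =O[𝓝 0] fun h => h ^ n := h3.const_mul_left _
  refine (h4.add h5).congr_left fun h => ?_
  rw [Finset.sum_range_succ]
  ring

/-- The defects of a function `g` in the quadrature formulas of a scheme. -/
def defect (A : Matrix (Fin (s + 1)) (Fin (s + 1)) ℝ) (c : Fin (s + 1) → ℝ) (g : ℝ → ℝ)
    (t h : ℝ) : Fin (s + 1) → ℝ :=
  fun i => g (t + c i * h) - g t - h * (A *ᵥ fun j => deriv g (t + c j * h)) i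

/-- The coefficients of the Taylor expansion of the defects. -/
def defectCoeff (A : Matrix (Fin (s + 1)) (Fin (s + 1)) ℝ) (c : Fin (s + 1) → ℝ) (k : ℕ) :
    Fin (s + 1) → ℝ :=
  fun i => c i ^ (k + 1) / (k + 1) - (A *ᵥ fun j => c j ^ k) i

/-- Each Taylor coefficient splits into a derivative of `g` and a vector depending only on the
scheme, so order conditions become linear equations for `defectCoeff`. The factor `h` before `A`
compensates for the derivative lost in `deriv g`. -/
theorem defect_expansion {g : ℝ → ℝ} {n : ℕ} (hg : ContDiff ℝ (n + 1 : ℕ) g) (t : ℝ)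
    (i : Fin (s + 1)) :
    (fun h : ℝ => defect A c g t h i - ∑ k ∈ Finset.range n,
      h ^ (k + 1) * (iteratedDeriv (k + 1) g t / k.factorial * defectCoeff A c k i))
      =O[𝓝 0] fun h => h ^ (n + 1) := by
  have h1 := taylor_isBigO hg t (c i)
  have hg' : ContDiff ℝ n (deriv g) := by
    have hg'' : ContDiff ℝ ((n : WithTop ℕ∞) + 1) g := by exact_mod_cast hg
    exact (contDiff_succ_iff_deriv.1 hg'').2.2
  have h2 : (fun h : ℝ => h * ∑ j, A i j * (deriv g (t + c j * h) -
      ∑ k ∈ Finset.range n, iteratedDeriv k (deriv g) t / k.factorial * (c j * h) ^ k))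
      =O[𝓝 0] fun h => h ^ (n + 1) := by
    have h3 : (fun h : ℝ => ∑ j, A i j * (deriv g (t + c j * h) -
      ∑ k ∈ Finset.range n, iteratedDeriv k (deriv g) t / k.factorial * (c j * h) ^ k))
      =O[𝓝 0] fun h => h ^ n :=
      IsBigO.fun_sum fun j _ => (taylor_isBigO hg' t (c j)).const_mul_left _
    exact ((isBigO_refl (fun h : ℝ => h) _).mul h3).congr_right fun h => by ring
  refine (h1.sub h2).congr_left fun h => ?_
  rw [Finset.sum_range_succ']
  simp only [defect, defectCoeff, Matrix.mulVec, dotProduct, mul_sub, Finset.sum_sub_distrib]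
  have h4 : ∑ k ∈ Finset.range n,
        iteratedDeriv (k + 1) g t / (k + 1).factorial * (c i * h) ^ (k + 1) =
      ∑ k ∈ Finset.range n, h ^ (k + 1) * (iteratedDeriv (k + 1) g t / k.factorial *
        (c i ^ (k + 1) / (k + 1))) := by
    refine Finset.sum_congr rfl fun k _ => ?_
    have h5 : ((k + 1).factorial : ℝ) = (k + 1) * k.factorial := by
      push_cast [Nat.factorial_succ]; ring
    have h6 : (k.factorial : ℝ) ≠ 0 := by positivity
    have h7 : (k + 1 : ℝ) ≠ 0 := by positivity
    rw [h5, mul_pow]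
    field_simp
  have h5 : h * ∑ j, A i j * ∑ k ∈ Finset.range n,
        iteratedDeriv k (deriv g) t / k.factorial * (c j * h) ^ k =
      ∑ k ∈ Finset.range n, h ^ (k + 1) * (iteratedDeriv (k + 1) g t / k.factorial *
        ∑ j, A i j * c j ^ k) := by
    simp only [Finset.mul_sum, iteratedDeriv_succ']
    rw [Finset.sum_comm]
    exact Finset.sum_congr rfl fun k _ => Finset.sum_congr rfl fun j _ => by ring
  rw [h4, h5]
  simp
  ring

/-- The order of a linear combination of the defects. -/
theorem mulVec_defect_isBigO {g : ℝ → ℝ} {n m : ℕ} (hg : ContDiff ℝ (n + 1 : ℕ) g) (hm : m ≤ n)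
    (t : ℝ) (B : Matrix (Fin (s + 1)) (Fin (s + 1)) ℝ) (i : Fin (s + 1))
    (hB : ∀ k < m, (B *ᵥ defectCoeff A c k) i = 0) :
    (fun h : ℝ => (B *ᵥ defect A c g t h) i) =O[𝓝 0] fun h => h ^ (m + 1) := by
  have hpow : ∀ {a b : ℕ}, a ≤ b → (fun h : ℝ => h ^ b) =O[𝓝 0] fun h => h ^ a := fun hab =>
    (eq_or_lt_of_le hab).elim (fun e => e ▸ isBigO_refl _ _)
      fun hlt => (isLittleO_pow_pow hlt).isBigO
  have h1 : (fun h : ℝ => ∑ j, B i j * (defect A c g t h j - ∑ k ∈ Finset.range n,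
      h ^ (k + 1) * (iteratedDeriv (k + 1) g t / k.factorial * defectCoeff A c k j)))
      =O[𝓝 0] fun h => h ^ (m + 1) :=
    IsBigO.fun_sum fun j _ =>
      ((defect_expansion hg t j).trans (hpow (by omega))).const_mul_left _
  have h2 : (fun h : ℝ => ∑ k ∈ Finset.range n,
      h ^ (k + 1) * (iteratedDeriv (k + 1) g t / k.factorial * (B *ᵥ defectCoeff A c k) i))
      =O[𝓝 0] fun h => h ^ (m + 1) := by
    refine IsBigO.fun_sum fun k _ => ?_
    by_cases hk : k < m
    · simp only [hB k hk, mul_zero]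
      exact isBigO_zero _ _
    · refine ((hpow (show m + 1 ≤ k + 1 by omega)).const_mul_left
        (iteratedDeriv (k + 1) g t / k.factorial * (B *ᵥ defectCoeff A c k) i)).congr_left
        fun h => by ring
  refine (h1.add h2).congr_left fun h => ?_
  simp only [mul_sub, Finset.sum_sub_distrib, Matrix.mulVec, dotProduct, Finset.mul_sum]
  rw [Finset.sum_comm (s := Finset.range n)]
  have h3 : ∀ k ∈ Finset.range n, ∀ j, h ^ (k + 1) * (iteratedDeriv (k + 1) g t / k.factorial *
      (B i j * defectCoeff A c k j)) = B i j * (h ^ (k + 1) *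
      (iteratedDeriv (k + 1) g t / k.factorial * defectCoeff A c k j)) := fun k _ j => by ring
  rw [sub_add_eq_add_sub, sub_eq_iff_eq_add]
  congr 1
  exact Finset.sum_congr rfl fun j _ => Finset.sum_congr rfl fun k hk => h3 k hk j

/-! ### Stability of the stage equations -/

theorem exists_norm_mulVec_le (A : Matrix (Fin (s + 1)) (Fin (s + 1)) ℝ) :
    ∃ C, 0 ≤ C ∧ ∀ x : Fin (s + 1) → ℝ, ‖A *ᵥ x‖ ≤ C * ‖x‖ :=
  ⟨‖(Matrix.mulVecLin A).toContinuousLinearMap‖, norm_nonneg _, fun x =>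
    (Matrix.mulVecLin A).toContinuousLinearMap.le_opNorm x⟩

theorem mulVec_isBigO (A : Matrix (Fin (s + 1)) (Fin (s + 1)) ℝ) {l : Filter ℝ}
    {x : ℝ → Fin (s + 1) → ℝ} {y : ℝ → ℝ} (hx : x =O[l] y) : (fun h => A *ᵥ x h) =O[l] y :=
  ((Matrix.mulVecLin A).toContinuousLinearMap.isBigO_comp x l).trans hx

/-- The right-hand sides depend on the errors only through a factor `h`. Once `|h| K ≤ 1/2`, that
part is absorbed on the left, and the errors are at most twice the defects. -/
theorem stage_errors_isBigO {l : Filter ℝ} (hl : l ≤ 𝓝 0)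
    {eU eV dU dV : ℝ → Fin (s + 1) → ℝ} {p q : ℝ} {y : ℝ → ℝ}
    (hU : ∀ᶠ h in l, eU h = h • A *ᵥ eV h - dU h)
    (hV : ∀ᶠ h in l, eV h = h • A *ᵥ (-(p • eV h + q • eU h)) - dV h)
    (hdU : dU =O[l] y) (hdV : dV =O[l] y) : eU =O[l] y ∧ eV =O[l] y := by
  obtain ⟨C, hC, hA⟩ := exists_norm_mulVec_le A
  set K := C * (1 + |p| + |q|) with hK
  have hK0 : 0 ≤ K := by positivity
  have hsmall : ∀ᶠ h in l, |h| * K ≤ 1 / 2 := by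
    have : Tendsto (fun h : ℝ => |h| * K) (𝓝 0) (𝓝 0) := by
      have : Continuous fun h : ℝ => |h| * K := by fun_prop
      simpa using this.tendsto 0
    exact hl ((this.eventually_lt_const (by norm_num)).mono fun h => le_of_lt)
  have key : ∀ᶠ h in l, ‖eU h‖ + ‖eV h‖ ≤ 2 * (‖dU h‖ + ‖dV h‖) := by
    filter_upwards [hU, hV, hsmall] with h h1 h2 h3
    have n1 : ‖eU h‖ ≤ |h| * (C * ‖eV h‖) + ‖dU h‖ := by
      calc ‖eU h‖ = ‖h • A *ᵥ eV h - dU h‖ := by rw [← h1]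
        _ ≤ ‖h • A *ᵥ eV h‖ + ‖dU h‖ := norm_sub_le _ _
        _ ≤ _ := by
          rw [norm_smul, Real.norm_eq_abs]
          gcongr
          exact hA _
    have n2 : ‖eV h‖ ≤ |h| * (C * (|p| * ‖eV h‖ + |q| * ‖eU h‖)) + ‖dV h‖ := by
      calc ‖eV h‖ = ‖h • A *ᵥ (-(p • eV h + q • eU h)) - dV h‖ := by rw [← h2]
        _ ≤ ‖h • A *ᵥ (-(p • eV h + q • eU h))‖ + ‖dV h‖ := norm_sub_le _ _
        _ ≤ _ := by
          rw [norm_smul, Real.norm_eq_abs]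
          gcongr
          refine (hA _).trans ?_
          gcongr
          rw [norm_neg]
          refine (norm_add_le _ _).trans ?_
          rw [norm_smul, norm_smul, Real.norm_eq_abs, Real.norm_eq_abs]
    have n3 : |h| * (C * ‖eV h‖) + |h| * (C * (|p| * ‖eV h‖ + |q| * ‖eU h‖)) ≤
        |h| * K * (‖eU h‖ + ‖eV h‖) := by
      have e1 : 0 ≤ |h| * C * (‖eU h‖ + |p| * ‖eU h‖ + |q| * ‖eV h‖) := by positivity
      rw [hK]
      linarith
    have n4 : |h| * K * (‖eU h‖ + ‖eV h‖) ≤ 1 / 2 * (‖eU h‖ + ‖eV h‖) := by gcongr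
    linarith
  have hd : (fun h => 2 * (‖dU h‖ + ‖dV h‖)) =O[l] y :=
    (hdU.norm_left.add hdV.norm_left).const_mul_left 2
  constructor
  · refine IsBigO.trans (IsBigO.of_bound 1 ?_) hd
    filter_upwards [key] with h hh
    rw [one_mul, Real.norm_eq_abs]
    exact le_trans (by linarith [norm_nonneg (eV h)]) (le_abs_self _)
  · refine IsBigO.trans (IsBigO.of_bound 1 ?_) hd
    filter_upwards [key] with h hh
    rw [one_mul, Real.norm_eq_abs]
    exact le_trans (by linarith [norm_nonneg (eU h)]) (le_abs_self _)

/-! ### Sufficient conditions for fifth-order accuracy -/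

/-- Fifth-order conditions for a scheme with an explicit starting row whose stages are of
order two. -/
structure OrderFive (A : Matrix (Fin (s + 1)) (Fin (s + 1)) ℝ) (c : Fin (s + 1) → ℝ) : Prop where
  row_zero : ∀ j, A 0 j = 0
  node_last : c (Fin.last s) = 1
  stage_zero : ∀ i, (A *ᵥ fun _ => 1) i = c i
  stage_one : ∀ i, (A *ᵥ c) i = c i ^ 2 / 2
  moment_two : (A *ᵥ fun j => c j ^ 2) (Fin.last s) = 1 / 3
  moment_three : (A *ᵥ fun j => c j ^ 3) (Fin.last s) = 1 / 4
  moment_four : (A *ᵥ fun j => c j ^ 4) (Fin.last s) = 1 / 5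
  iterated_two : (A *ᵥ A *ᵥ fun j => c j ^ 2) (Fin.last s) = 1 / 12
  iterated_three : (A *ᵥ A *ᵥ fun j => c j ^ 3) (Fin.last s) = 1 / 20
  twice_iterated_two : (A *ᵥ A *ᵥ A *ᵥ fun j => c j ^ 2) (Fin.last s) = 1 / 60

namespace OrderFive

theorem defectCoeff_zero (H : OrderFive A c) : defectCoeff A c 0 = 0 := by
  funext i
  simp [defectCoeff, H.stage_zero]

theorem defectCoeff_one (H : OrderFive A c) : defectCoeff A c 1 = 0 := by
  funext i
  have := H.stage_one i
  simp only [defectCoeff, pow_one, this, Pi.zero_apply]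
  norm_num

theorem defectCoeff_eq (A : Matrix (Fin (s + 1)) (Fin (s + 1)) ℝ) (c : Fin (s + 1) → ℝ) (k : ℕ) :
    defectCoeff A c k = ((k : ℝ) + 1)⁻¹ • (fun i => c i ^ (k + 1)) - A *ᵥ fun j => c j ^ k := by
  funext i
  simp [defectCoeff, div_eq_inv_mul]

theorem defectCoeff_last (H : OrderFive A c) :
    ∀ k < 5, defectCoeff A c k (Fin.last s) = 0 := by
  intro k hk
  interval_cases k
  · rw [H.defectCoeff_zero]; rfl
  · rw [H.defectCoeff_one]; rfl
  · rw [defectCoeff, H.moment_two, H.node_last]; norm_num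
  · rw [defectCoeff, H.moment_three, H.node_last]; norm_num
  · rw [defectCoeff, H.moment_four, H.node_last]; norm_num

theorem mulVec_defectCoeff_last (H : OrderFive A c) :
    ∀ k < 4, (A *ᵥ defectCoeff A c k) (Fin.last s) = 0 := by
  intro k hk
  interval_cases k
  · rw [H.defectCoeff_zero]; simp
  · rw [H.defectCoeff_one]; simp
  · rw [defectCoeff_eq, Matrix.mulVec_sub, Matrix.mulVec_smul, Pi.sub_apply, Pi.smul_apply,
      H.iterated_two, H.moment_three]
    norm_num
  · rw [defectCoeff_eq, Matrix.mulVec_sub, Matrix.mulVec_smul, Pi.sub_apply, Pi.smul_apply,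
      H.iterated_three, H.moment_four]
    norm_num

theorem mulVec_mulVec_defectCoeff_last (H : OrderFive A c) :
    ∀ k < 3, ((A * A) *ᵥ defectCoeff A c k) (Fin.last s) = 0 := by
  intro k hk
  interval_cases k
  · rw [H.defectCoeff_zero]; simp
  · rw [H.defectCoeff_one]; simp
  · rw [defectCoeff_eq, ← Matrix.mulVec_mulVec, Matrix.mulVec_sub, Matrix.mulVec_smul,
      Matrix.mulVec_sub, Matrix.mulVec_smul, Pi.sub_apply, Pi.smul_apply,
      H.twice_iterated_two, H.iterated_three]
    norm_num

theorem defect_isBigO (H : OrderFive A c) {g : ℝ → ℝ} (hg : ContDiff ℝ 6 g) (t : ℝ) :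
    (fun h => defect A c g t h) =O[𝓝 0] fun h => h ^ 3 := by
  rw [isBigO_pi]
  intro i
  have := mulVec_defect_isBigO (A := A) (c := c) (n := 5) (m := 2) hg (by norm_num) t 1 i ?_
  · simpa using this
  · intro k hk
    interval_cases k
    · rw [H.defectCoeff_zero]; simp
    · rw [H.defectCoeff_one]; simp

theorem defect_last_isBigO (H : OrderFive A c) {g : ℝ → ℝ} (hg : ContDiff ℝ 6 g) (t : ℝ) :
    (fun h => defect A c g t h (Fin.last s)) =O[𝓝 0] fun h => h ^ 6 := by
  have := mulVec_defect_isBigO (A := A) (c := c) (n := 5) (m := 5) hg le_rfl t 1 (Fin.last s) ?_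
  · simpa using this
  · simpa using H.defectCoeff_last

theorem mulVec_defect_last_isBigO (H : OrderFive A c) {g : ℝ → ℝ} (hg : ContDiff ℝ 6 g) (t : ℝ) :
    (fun h => (A *ᵥ defect A c g t h) (Fin.last s)) =O[𝓝 0] fun h => h ^ 5 :=
  mulVec_defect_isBigO (n := 5) (m := 4) hg (by norm_num) t A _ H.mulVec_defectCoeff_last

theorem mulVec_mulVec_defect_last_isBigO (H : OrderFive A c) {g : ℝ → ℝ} (hg : ContDiff ℝ 6 g)
    (t : ℝ) : (fun h => (A *ᵥ A *ᵥ defect A c g t h) (Fin.last s)) =O[𝓝 0] fun h => h ^ 4 := by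
  have := mulVec_defect_isBigO (A := A) (c := c) (n := 5) (m := 3) hg (by norm_num) t (A * A) _
    H.mulVec_mulVec_defectCoeff_last
  simpa only [Matrix.mulVec_mulVec] using this

end OrderFive

/-! ### Regularity of solutions and the local error -/

/-- Solutions of the oscillator equation with a load of class `C^n` are of class `C^(n+1)`,
together with their velocities. -/
theorem contDiff_solution {ξ ω : ℝ} {f u v : ℝ → ℝ} {n : ℕ} (hf : ContDiff ℝ n f)
    (hu : ∀ t, HasDerivAt u (v t) t)
    (hv : ∀ t, HasDerivAt v (f t - 2 * ξ * ω * v t - ω ^ 2 * u t) t) :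
    ContDiff ℝ (n + 1 : ℕ) u ∧ ContDiff ℝ (n + 1 : ℕ) v := by
  have hdu : deriv u = v := funext fun t => (hu t).deriv
  have hdv : deriv v = fun t => f t - 2 * ξ * ω * v t - ω ^ 2 * u t :=
    funext fun t => (hv t).deriv
  have hu1 : Differentiable ℝ u := fun t => (hu t).differentiableAt
  have hv1 : Differentiable ℝ v := fun t => (hv t).differentiableAt
  have step : ∀ m : ℕ, m ≤ n → ContDiff ℝ m u → ContDiff ℝ m v →
      ContDiff ℝ (m + 1 : ℕ) u ∧ ContDiff ℝ (m + 1 : ℕ) v := by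
    intro m hm h1 h2
    have hfm : ContDiff ℝ m f := hf.of_le (by exact_mod_cast hm)
    push_cast
    constructor
    · refine contDiff_succ_iff_deriv.2 ⟨hu1, by simp, ?_⟩
      rwa [hdu]
    · refine contDiff_succ_iff_deriv.2 ⟨hv1, by simp, ?_⟩
      rw [hdv]
      fun_prop
  have all : ∀ m : ℕ, m ≤ n + 1 → ContDiff ℝ m u ∧ ContDiff ℝ m v := by
    intro m
    induction m with
    | zero =>
      intro _
      exact ⟨contDiff_zero.2 hu1.continuous, contDiff_zero.2 hv1.continuous⟩
    | succ m ih =>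
      intro hm
      exact step m (by omega) (ih (by omega)).1 (ih (by omega)).2
  exact all _ le_rfl

/-- A uniform bound on the stages gives only `h^3`; the other three powers appear only in the last
row, each time one more factor `h A` of the recursion is unrolled. -/
theorem OrderFive.locallyAccurate (H : OrderFive A c) : LocallyAccurate 5 A c := by
  intro ξ ω f u v hf hu hv tn
  have hl : 𝓝[>] (0 : ℝ) ≤ 𝓝 0 := nhdsWithin_le_nhds
  refine ⟨((eventually_isUnit_stageMatrix A ξ ω).filter_mono hl).mono fun h hh =>
    existsUnique_isStep H.row_zero hh, ?_⟩
  intro U V W hstep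
  obtain ⟨hu6, hv6⟩ := contDiff_solution (n := 5) hf hu hv
  have hdu : deriv u = v := funext fun t => (hu t).deriv
  have hdv : deriv v = fun t => f t - 2 * ξ * ω * v t - ω ^ 2 * u t :=
    funext fun t => (hv t).deriv
  set eU : ℝ → Fin (s + 1) → ℝ := fun h i => U h i - u (tn + c i * h) with heU
  set eV : ℝ → Fin (s + 1) → ℝ := fun h i => V h i - v (tn + c i * h) with heV
  set eW : ℝ → Fin (s + 1) → ℝ := fun h => -((2 * ξ * ω) • eV h + (ω ^ 2) • eU h) with heW
  set dU : ℝ → Fin (s + 1) → ℝ := fun h => defect A c u tn h with hdU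
  set dV : ℝ → Fin (s + 1) → ℝ := fun h => defect A c v tn h with hdV
  have hrow : ∀ X : Fin (s + 1) → ℝ, (A *ᵥ X) 0 = 0 := fun X => by
    simp [Matrix.mulVec, dotProduct, H.row_zero]
  have hc0 : c 0 = 0 := by rw [← H.stage_zero 0, hrow]
  have eqU : ∀ᶠ h in 𝓝[>] (0 : ℝ), eU h = h • A *ᵥ eV h - dU h := by
    filter_upwards [hstep] with h hs
    funext i
    have e1 : U h i = u tn + h * (A *ᵥ V h) i := by
      by_cases hi : i = 0
      · subst hi; rw [hs.start_disp, hrow]; ring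
      · exact hs.disp i hi
    have e2 : eV h = V h - fun j => v (tn + c j * h) := rfl
    simp only [heU, hdU, defect, hdu, e2, Matrix.mulVec_sub, Pi.sub_apply, Pi.smul_apply,
      smul_eq_mul, e1]
    ring
  have eqV : ∀ᶠ h in 𝓝[>] (0 : ℝ), eV h = h • A *ᵥ eW h - dV h := by
    filter_upwards [hstep] with h hs
    funext i
    have e1 : V h i = v tn + h * (A *ᵥ W h) i := by
      by_cases hi : i = 0
      · subst hi; rw [hs.start_vel, hrow]; ring
      · exact hs.vel i hi
    have e2 : eW h = W h - fun j => deriv v (tn + c j * h) := by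
      funext j
      simp only [heW, heU, heV, hdv, Pi.neg_apply, Pi.add_apply, Pi.sub_apply, Pi.smul_apply,
        smul_eq_mul]
      linear_combination -hs.equilibrium j
    simp only [e2, hdV, defect, Matrix.mulVec_sub, Pi.sub_apply, Pi.smul_apply,
      smul_eq_mul]
    simp only [heV, e1]
    ring
  have hdU3 : dU =O[𝓝[>] 0] fun h : ℝ => h ^ 3 := (H.defect_isBigO hu6 tn).mono hl
  have hdV3 : dV =O[𝓝[>] 0] fun h : ℝ => h ^ 3 := (H.defect_isBigO hv6 tn).mono hl
  obtain ⟨hU3, hV3⟩ := stage_errors_isBigO hl eqU eqV hdU3 hdV3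
  have hW3 : eW =O[𝓝[>] 0] fun h : ℝ => h ^ 3 :=
    ((hV3.const_smul_left (2 * ξ * ω)).add (hU3.const_smul_left (ω ^ 2))).neg_left
  have hmul : ∀ (n : ℕ) {x : ℝ → ℝ}, x =O[𝓝[>] 0] (fun h : ℝ => h ^ n) →
      (fun h => h * x h) =O[𝓝[>] 0] fun h : ℝ => h ^ (n + 1) := fun n x hx =>
    ((isBigO_refl (fun h : ℝ => h) _).mul hx).congr_right fun h => by ring
  have hsmul : ∀ (n : ℕ) {x : ℝ → Fin (s + 1) → ℝ}, x =O[𝓝[>] 0] (fun h : ℝ => h ^ n) →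
      (fun h => h • x h) =O[𝓝[>] 0] fun h : ℝ => h ^ (n + 1) := fun n x hx =>
    ((isBigO_refl (fun h : ℝ => h) _).smul hx).congr_right fun h => by
      rw [smul_eq_mul]; ring
  -- The sum of error and defect is `h A` applied to an `O(h^3)` error. So modulo `O(h^4)` the error
  -- is minus the defect, and the conditions on `A² d` apply to `A² e`.
  have hV4 : (fun h => eV h + dV h) =O[𝓝[>] 0] fun h : ℝ => h ^ 4 := by
    refine (hsmul 3 (mulVec_isBigO A hW3)).congr' ?_ EventuallyEq.rfl
    filter_upwards [eqV] with h hh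
    rw [hh]; abel
  have hU4 : (fun h => eU h + dU h) =O[𝓝[>] 0] fun h : ℝ => h ^ 4 := by
    refine (hsmul 3 (mulVec_isBigO A hV3)).congr' ?_ EventuallyEq.rfl
    filter_upwards [eqU] with h hh
    rw [hh]; abel
  have last : ∀ {x : ℝ → Fin (s + 1) → ℝ} {y : ℝ → ℝ}, x =O[𝓝[>] 0] y →
      (fun h => x h (Fin.last s)) =O[𝓝[>] 0] y := fun hx => isBigO_pi.1 hx _
  have hAAV : (fun h => (A *ᵥ A *ᵥ eV h) (Fin.last s)) =O[𝓝[>] 0] fun h : ℝ => h ^ 4 := by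
    have h1 := last (mulVec_isBigO A (mulVec_isBigO A hV4))
    refine (h1.sub ((H.mulVec_mulVec_defect_last_isBigO hv6 tn).mono hl)).congr_left fun h => ?_
    simp [hdV, Matrix.mulVec_add]
  have hAAU : (fun h => (A *ᵥ A *ᵥ eU h) (Fin.last s)) =O[𝓝[>] 0] fun h : ℝ => h ^ 4 := by
    have h1 := last (mulVec_isBigO A (mulVec_isBigO A hU4))
    refine (h1.sub ((H.mulVec_mulVec_defect_last_isBigO hu6 tn).mono hl)).congr_left fun h => ?_
    simp [hdU, Matrix.mulVec_add]
  have hAAW : (fun h => (A *ᵥ A *ᵥ eW h) (Fin.last s)) =O[𝓝[>] 0] fun h : ℝ => h ^ 4 := by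
    refine ((hAAV.const_mul_left (2 * ξ * ω)).add
      (hAAU.const_mul_left (ω ^ 2))).neg_left.congr_left fun h => ?_
    simp [heW, Matrix.mulVec_add, Matrix.mulVec_smul, Matrix.mulVec_neg]
  have hAV : (fun h => (A *ᵥ eV h) (Fin.last s)) =O[𝓝[>] 0] fun h : ℝ => h ^ 5 := by
    refine ((hmul 4 hAAW).sub ((H.mulVec_defect_last_isBigO hv6 tn).mono hl)).congr' ?_
      EventuallyEq.rfl
    filter_upwards [eqV] with h hh
    rw [hh]
    simp [hdV, Matrix.mulVec_sub, Matrix.mulVec_smul]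
  have hAU : (fun h => (A *ᵥ eU h) (Fin.last s)) =O[𝓝[>] 0] fun h : ℝ => h ^ 5 := by
    refine ((hmul 4 hAAV).sub ((H.mulVec_defect_last_isBigO hu6 tn).mono hl)).congr' ?_
      EventuallyEq.rfl
    filter_upwards [eqU] with h hh
    rw [hh]
    simp [hdU, Matrix.mulVec_sub, Matrix.mulVec_smul]
  have hAW : (fun h => (A *ᵥ eW h) (Fin.last s)) =O[𝓝[>] 0] fun h : ℝ => h ^ 5 := by
    refine ((hAV.const_mul_left (2 * ξ * ω)).add
      (hAU.const_mul_left (ω ^ 2))).neg_left.congr_left fun h => ?_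
    simp [heW, Matrix.mulVec_add, Matrix.mulVec_smul, Matrix.mulVec_neg]
  constructor
  · refine ((hmul 5 hAV).sub ((H.defect_last_isBigO hu6 tn).mono hl)).congr' ?_ EventuallyEq.rfl
    filter_upwards [eqU] with h hh
    have := congrFun hh (Fin.last s)
    simp only [heU, H.node_last, one_mul] at this
    rw [this]
    rfl
  · refine ((hmul 5 hAW).sub ((H.defect_last_isBigO hv6 tn).mono hl)).congr' ?_ EventuallyEq.rfl
    filter_upwards [eqV] with h hh
    have := congrFun hh (Fin.last s)
    simp only [heV, H.node_last, one_mul] at this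
    rw [this]
    rfl

/-! ### Accuracy of the amplification matrix and of the load operator -/

/-- All entries of `Dexa`, and those of `Lexa` up to a multiple of `exp`, have this form, so
checking the differential equations reduces to comparing coefficients, with `ν² = (1 - ξ²) ω²`. -/
theorem hasDerivAt_exp_mul_trig (κ ν a b t : ℝ) :
    HasDerivAt (fun t => Real.exp (κ * t) * (a * Real.cos (ν * t) + b * Real.sin (ν * t)))
      (Real.exp (κ * t) * ((κ * a + ν * b) * Real.cos (ν * t) +
        (κ * b - ν * a) * Real.sin (ν * t))) t := by
  have hlin : ∀ m : ℝ, HasDerivAt (fun t : ℝ => m * t) m t := fun m => by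
    simpa using (hasDerivAt_id t).const_mul m
  have h := (hlin κ).exp.mul (((hlin ν).cos.const_mul a).add ((hlin ν).sin.const_mul b))
  refine h.congr_deriv ?_
  simp only [Pi.add_apply]
  ring

theorem dampedFreq_sq {ξ : ℝ} (ω : ℝ) (h0 : 0 ≤ ξ) (h1 : ξ < 1) :
    dampedFreq ξ ω ^ 2 = (1 - ξ ^ 2) * ω ^ 2 := by
  rw [dampedFreq, mul_pow, Real.sq_sqrt]
  nlinarith

theorem dampedFreq_pos {ξ ω : ℝ} (h0 : 0 ≤ ξ) (h1 : ξ < 1) (hω : 0 < ω) :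
    0 < dampedFreq ξ ω :=
  mul_pos (Real.sqrt_pos.2 (by nlinarith)) hω

/-- The columns of the exact amplification matrix solve the homogeneous oscillator equation. -/
theorem hasDerivAt_Dexa {ξ ω : ℝ} (h0 : 0 ≤ ξ) (h1 : ξ < 1) (hω : 0 < ω) (j : Fin 2) (t : ℝ) :
    HasDerivAt (fun t => Dexa ξ ω t 0 j) (Dexa ξ ω t 1 j) t ∧
    HasDerivAt (fun t => Dexa ξ ω t 1 j)
      (-(2 * ξ * ω) * Dexa ξ ω t 1 j - ω ^ 2 * Dexa ξ ω t 0 j) t := by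
  have hsq := dampedFreq_sq ω h0 h1
  have hpos := dampedFreq_pos h0 h1 hω
  have key := fun a b => hasDerivAt_exp_mul_trig (-ξ * ω) (dampedFreq ξ ω) a b t
  simp only [Dexa]
  set ν := dampedFreq ξ ω
  have hne := hpos.ne'
  fin_cases j
  · constructor
    · refine ((key 1 (ξ * ω / ν)).congr_deriv ?_).congr_of_eventuallyEq
        (Eventually.of_forall fun x => ?_)
      · simp
        field_simp
        linear_combination (-Real.sin (t * ν)) * hsq
      · simp
    · refine ((key 0 (-(ω ^ 2 / ν))).congr_deriv ?_).congr_of_eventuallyEq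
        (Eventually.of_forall fun x => ?_)
      · simp
        field_simp
        ring
      · simp
  · constructor
    · refine ((key 0 (1 / ν)).congr_deriv ?_).congr_of_eventuallyEq
        (Eventually.of_forall fun x => ?_)
      · simp
        field_simp
        ring
      · simp
    · refine ((key 1 (-(ξ * ω / ν))).congr_deriv ?_).congr_of_eventuallyEq
        (Eventually.of_forall fun x => ?_)
      · simp
        field_simp
        linear_combination (-Real.sin (t * ν)) * hsq
      · simp
        ring

theorem Dexa_zero {ξ ω : ℝ} : Dexa ξ ω 0 = 1 := by
  ext i j
  fin_cases i <;> fin_cases j <;> simp [Dexa]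

/-- The exact load operator solves the oscillator equation with load `exp`. -/
theorem hasDerivAt_Lexa {ξ ω : ℝ} (h0 : 0 ≤ ξ) (h1 : ξ < 1) (hω : 0 < ω) (t : ℝ) :
    HasDerivAt (fun t => Lexa ξ ω t 0) (Lexa ξ ω t 1) t ∧
    HasDerivAt (fun t => Lexa ξ ω t 1)
      (Real.exp t - 2 * ξ * ω * Lexa ξ ω t 1 - ω ^ 2 * Lexa ξ ω t 0) t := by
  have hsq := dampedFreq_sq ω h0 h1
  have hpos := dampedFreq_pos h0 h1 hω
  have key := fun a b => hasDerivAt_exp_mul_trig (-ξ * ω) (dampedFreq ξ ω) a b t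
  simp only [Lexa]
  set ν := dampedFreq ξ ω
  have hq : 0 < ω ^ 2 + 2 * ξ * ω + 1 := by positivity
  set q := ω ^ 2 + 2 * ξ * ω + 1 with hqdef
  have hne := hpos.ne'
  have hqne := hq.ne'
  have hexp : HasDerivAt (fun t => Real.exp t / q) (Real.exp t / q) t :=
    (Real.hasDerivAt_exp t).div_const q
  constructor
  · refine ((hexp.sub (key (1 / q) ((1 + ξ * ω) / (ν * q)))).congr_deriv ?_).congr_of_eventuallyEq
      (Eventually.of_forall fun x => ?_)
    · simp
      field_simp
      linear_combination (Real.exp (-(ξ * ω * t)) * Real.sin (t * ν)) * hsq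
    · simp
      field_simp
  · refine ((hexp.add (key (-1 / q) ((ω ^ 2 + ξ * ω) / (ν * q)))).congr_deriv ?_
      ).congr_of_eventuallyEq (Eventually.of_forall fun x => ?_)
    · simp
      field_simp
      linear_combination (Real.exp (-(ξ * ω * t)) * Real.sin (t * ν)) * hsq
    · simp
      field_simp
      ring_nf

theorem Lexa_zero {ξ ω : ℝ} (h0 : 0 ≤ ξ) (h1 : ξ < 1) (hω : 0 < ω) : Lexa ξ ω 0 = 0 := by
  have hpos := dampedFreq_pos h0 h1 hω
  have hq : 0 < ω ^ 2 + 2 * ξ * ω + 1 := by positivity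
  ext i
  fin_cases i
  · simp [Lexa]
    field_simp
    simp
  · simp [Lexa]
    field_simp
    simp

/-- The local errors of one step, in terms of the amplification matrix. -/
theorem LocallyAccurate.isBigO {p : ℕ} (hacc : LocallyAccurate p A c) (hA : ∀ j, A 0 j = 0)
    {ξ ω : ℝ} {f u v : ℝ → ℝ} (hf : ContDiff ℝ p f) (hu : ∀ t, HasDerivAt u (v t) t)
    (hv : ∀ t, HasDerivAt v (f t - 2 * ξ * ω * v t - ω ^ 2 * u t) t) (i : Fin 2) :
    (fun h => (Dnum A ξ ω h *ᵥ ![u 0, v 0]) i +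
      ((updateMatrix A h * (stageMatrix A ξ ω h)⁻¹) *ᵥ
        Sum.elim (fun i => f (c i * h)) (fun _ => 0)) i - ![u h, v h] i)
      =O[𝓝[>] (0 : ℝ)] fun h => h ^ (p + 1) := by
  obtain ⟨hex, herr⟩ := hacc ξ ω f u v hf hu hv 0
  -- The error bounds speak of stage values as functions of `h`, so a solution is selected for every
  -- small `h`.
  obtain ⟨Y, hY⟩ := (hex.mono fun h hh => hh.exists).choice
  obtain ⟨hU, hV⟩ := herr (fun h => (Y h).1) (fun h => (Y h).2.1) (fun h => (Y h).2.2) hY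
  have hend := ((eventually_isUnit_stageMatrix A ξ ω).filter_mono
    (nhdsWithin_le_nhds (s := Set.Ioi 0))).and hY
  fin_cases i
  · refine hU.congr' ?_ EventuallyEq.rfl
    filter_upwards [hend] with h hh
    have := congrFun (hh.2.end_eq hA hh.1) 0
    simp only [zero_add, Pi.add_apply] at this ⊢
    rw [← Fin.zero_eta] at this
    simp only [← this]
    rfl
  · refine hV.congr' ?_ EventuallyEq.rfl
    filter_upwards [hend] with h hh
    have := congrFun (hh.2.end_eq hA hh.1) 1
    simp only [zero_add, Pi.add_apply] at this ⊢
    rw [← Fin.mk_one] at this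
    simp only [← this]
    rfl

/-- The load `0` with initial data `e_j` isolates column `j` of `Dnum`; the load `exp` with zero
initial data isolates `Lnum`. -/
theorem LocallyAccurate.operatorAccurate {p : ℕ} (hacc : LocallyAccurate p A c)
    (hA : ∀ j, A 0 j = 0) : OperatorAccurate p A c := by
  intro ξ ω h0 h1 hω
  refine ⟨(eventually_isUnit_stageMatrix A ξ ω).filter_mono nhdsWithin_le_nhds, ?_, ?_⟩
  · intro i j
    have h := hacc.isBigO hA (ξ := ξ) (ω := ω) (f := fun _ => 0) (u := fun t => Dexa ξ ω t 0 j)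
      (v := fun t => Dexa ξ ω t 1 j) contDiff_const
      (fun t => (hasDerivAt_Dexa h0 h1 hω j t).1)
      (fun t => (hasDerivAt_Dexa h0 h1 hω j t).2.congr_deriv (by ring)) i
    refine h.congr_left fun h => ?_
    have e1 : (Sum.elim (fun _ => 0) (fun _ => 0) : Fin (s + 1) ⊕ Fin (s + 1) → ℝ) = 0 := by
      funext x; rcases x with x | x <;> rfl
    rw [e1, Matrix.mulVec_zero]
    have e2 : ![Dexa ξ ω 0 0 j, Dexa ξ ω 0 1 j] = Pi.single j 1 := by
      rw [Dexa_zero]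
      funext x
      fin_cases x <;> fin_cases j <;> rfl
    have e3 : ![Dexa ξ ω h 0 j, Dexa ξ ω h 1 j] i = Dexa ξ ω h i j := by
      fin_cases i <;> rfl
    rw [e2, e3, Matrix.mulVec_single_one, Pi.zero_apply, add_zero]
    rfl
  · intro i
    have h := hacc.isBigO hA (f := Real.exp) (u := fun t => Lexa ξ ω t 0)
      (v := fun t => Lexa ξ ω t 1) Real.contDiff_exp
      (fun t => (hasDerivAt_Lexa h0 h1 hω t).1) (fun t => (hasDerivAt_Lexa h0 h1 hω t).2) i
    refine h.congr_left fun h => ?_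
    simp only [Lexa_zero h0 h1 hω]
    have e1 : ![(0 : Fin 2 → ℝ) 0, (0 : Fin 2 → ℝ) 1] = 0 := by
      funext x; fin_cases x <;> rfl
    rw [e1, Matrix.mulVec_zero, Pi.zero_apply, zero_add, Lnum]
    congr 1

/-! ### The high-frequency limit -/

/-- `A` itself is singular, but `x ↦ (A x, x 0)` is injective, hence bounded below in finite
dimension. -/
theorem exists_norm_le_mulVec (hker : ∀ x : Fin (s + 1) → ℝ, x 0 = 0 → A *ᵥ x = 0 → x = 0) :
    ∃ C, 0 ≤ C ∧ ∀ x : Fin (s + 1) → ℝ, x 0 = 0 → ‖x‖ ≤ C * ‖A *ᵥ x‖ := by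
  set L : (Fin (s + 1) → ℝ) →ₗ[ℝ] (Fin (s + 1) → ℝ) × ℝ :=
    (Matrix.mulVecLin A).prod (LinearMap.proj 0) with hL
  have hinj : LinearMap.ker L = ⊥ := by
    refine LinearMap.ker_eq_bot'.2 fun x hx => ?_
    have h1 : A *ᵥ x = 0 := congrArg Prod.fst hx
    have h2 : x 0 = 0 := congrArg Prod.snd hx
    exact hker x h2 h1
  obtain ⟨K, _, hK⟩ := L.exists_antilipschitzWith hinj
  refine ⟨K, K.coe_nonneg, fun x hx => ?_⟩
  have h := hK.le_mul_dist x 0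
  have h3 : L x = (A *ᵥ x, 0) := by
    rw [hL]
    exact Prod.ext rfl hx
  rw [map_zero, dist_zero_right, dist_zero_right, h3, Prod.norm_def] at h
  simpa using h

/-- The stages of a stiff problem are small when their starting values vanish. -/
theorem exists_stiff_bound (hker : ∀ x : Fin (s + 1) → ℝ, x 0 = 0 → A *ᵥ x = 0 → x = 0)
    (ξ : ℝ) : ∃ K, 0 ≤ K ∧ ∀ τ, 0 < τ → K ≤ τ → ∀ x v a b : Fin (s + 1) → ℝ, x 0 = 0 → v 0 = 0 →
      x = a + τ • A *ᵥ v → v = b - τ • A *ᵥ ((2 * ξ) • v + x) →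
      τ * (‖x‖ + ‖v‖) ≤ K * (‖a‖ + ‖b‖) := by
  obtain ⟨C, hC, hA⟩ := exists_norm_le_mulVec hker
  have hK0 : 0 ≤ C * (1 + |2 * ξ|) := by positivity
  -- Dividing both equations by `τ` and inverting `A` bounds `τ (‖x‖ + ‖v‖)` by `C (1 + |2ξ|)` times
  -- all four norms; the factor 2 lets half of the left side absorb `‖x‖ + ‖v‖`.
  refine ⟨2 * (C * (1 + |2 * ξ|)), by positivity, ?_⟩
  intro τ hτ hKτ x v a b hx0 hv0 hx hv
  set y := (2 * ξ) • v + x with hy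
  have hy0 : y 0 = 0 := by simp [hy, hx0, hv0]
  have h1 : τ * ‖v‖ ≤ C * (‖x‖ + ‖a‖) := by
    have e : τ • A *ᵥ v = x - a := eq_sub_iff_add_eq.2 ((add_comm _ _).trans hx.symm)
    calc τ * ‖v‖ ≤ τ * (C * ‖A *ᵥ v‖) := by gcongr; exact hA v hv0
      _ = C * ‖τ • A *ᵥ v‖ := by rw [norm_smul, Real.norm_of_nonneg hτ.le]; ring
      _ ≤ _ := by rw [e]; gcongr; exact norm_sub_le _ _
  have h2 : τ * ‖y‖ ≤ C * (‖v‖ + ‖b‖) := by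
    have e : τ • A *ᵥ y = b - v := by rw [eq_sub_iff_add_eq, ← eq_sub_iff_add_eq']; exact hv
    calc τ * ‖y‖ ≤ τ * (C * ‖A *ᵥ y‖) := by gcongr; exact hA y hy0
      _ = C * ‖τ • A *ᵥ y‖ := by rw [norm_smul, Real.norm_of_nonneg hτ.le]; ring
      _ ≤ _ := by rw [e, add_comm ‖v‖]; gcongr; exact norm_sub_le _ _
  have h3 : ‖x‖ ≤ ‖y‖ + |2 * ξ| * ‖v‖ := by
    have e : x = y - (2 * ξ) • v := by rw [hy]; abel
    calc ‖x‖ = ‖y - (2 * ξ) • v‖ := by rw [← e]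
      _ ≤ _ := by
        refine (norm_sub_le _ _).trans ?_
        rw [norm_smul, Real.norm_eq_abs]
  have h4 : τ * (‖x‖ + ‖v‖) ≤ C * (1 + |2 * ξ|) * ((‖x‖ + ‖v‖) + (‖a‖ + ‖b‖)) := by
    have e1 : τ * ‖x‖ ≤ τ * (‖y‖ + |2 * ξ| * ‖v‖) := by gcongr
    have e2 : |2 * ξ| * (τ * ‖v‖) ≤ |2 * ξ| * (C * (‖x‖ + ‖a‖)) := by gcongr
    have e3 : 0 ≤ C * |2 * ξ| * (‖v‖ + ‖b‖) := by positivity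
    linarith
  have h5 : 2 * (C * (1 + |2 * ξ|)) * (‖x‖ + ‖v‖) ≤ τ * (‖x‖ + ‖v‖) := by gcongr
  linarith

variable {r : Fin (s + 1) → ℝ} {ξ ω h un vn : ℝ} {U V W : Fin (s + 1) → ℝ}

/-- For a stiff problem without load, the stages are close to multiples of the vector `r`
in the kernel of the coefficient matrix. -/
theorem exists_isStep_stiff_bound (hA : ∀ j, A 0 j = 0)
    (hker : ∀ x : Fin (s + 1) → ℝ, x 0 = 0 → A *ᵥ x = 0 → x = 0) (hr0 : r 0 = 1)
    (hr : A *ᵥ r = 0) (ξ : ℝ) : ∃ K, 0 ≤ K ∧ ∀ ω h, 0 < ω * h → K ≤ ω * h → ∀ un vn U V W,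
      IsStep A c ξ ω (fun _ => 0) 0 h un vn U V W →
      ω * h * (‖ω • U - (ω * un) • r‖ + ‖V - vn • r‖) ≤ K * (|ω * un| + |vn|) := by
  obtain ⟨K, hK, hbound⟩ := exists_stiff_bound hker ξ
  have hone : ‖(fun _ => 1) - r‖ ≤ 1 + ‖(fun _ => 1) - r‖ := by linarith
  refine ⟨K * (1 + ‖(fun _ => 1) - r‖), by positivity, ?_⟩
  intro ω h hτ hKτ un vn U V W H
  have hKτ' : K ≤ ω * h := le_trans (by nlinarith [norm_nonneg ((fun _ => (1 : ℝ)) - r)]) hKτ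
  have hrow : ∀ X : Fin (s + 1) → ℝ, (A *ᵥ X) 0 = 0 := fun X => by
    simp [Matrix.mulVec, dotProduct, hA]
  have hU : ∀ i, U i = un + h * (A *ᵥ V) i := by
    intro i
    by_cases hi : i = 0
    · subst hi; rw [H.start_disp, hrow]; ring
    · exact H.disp i hi
  have hV : ∀ i, V i = vn + h * (A *ᵥ W) i := by
    intro i
    by_cases hi : i = 0
    · subst hi; rw [H.start_vel, hrow]; ring
    · exact H.vel i hi
  have hW : W = -(ω • ((2 * ξ) • V + ω • U)) := by
    funext i
    have := H.equilibrium i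
    simp only [Pi.neg_apply, Pi.add_apply, Pi.smul_apply, smul_eq_mul]
    linear_combination this
  -- Multiplying displacements by `ω` puts the single stiffness parameter `ω h` in both equations.
  -- Subtracting multiples of `r` makes the starting entries vanish without changing the products
  -- with `A`.
  have key := hbound (ω * h) hτ hKτ' (ω • U - (ω * un) • r) (V - vn • r)
    ((ω * un) • ((fun _ => 1) - r)) (vn • ((fun _ => 1) - r))
    (by simp [H.start_disp, hr0]) (by simp [H.start_vel, hr0])
    (by
      rw [Matrix.mulVec_sub, Matrix.mulVec_smul, hr]
      funext i
      simp [hU i]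
      ring)
    (by
      have e : A *ᵥ ((2 * ξ) • (V - vn • r) + (ω • U - (ω * un) • r)) =
          A *ᵥ ((2 * ξ) • V + ω • U) := by
        simp [Matrix.mulVec_add, Matrix.mulVec_sub, Matrix.mulVec_smul, hr]
      rw [e]
      funext i
      have e2 := hV i
      rw [hW, Matrix.mulVec_neg, Matrix.mulVec_smul] at e2
      simp only [Pi.sub_apply, Pi.smul_apply, smul_eq_mul, Pi.neg_apply] at e2 ⊢
      linear_combination e2)
  refine key.trans ?_
  rw [norm_smul, norm_smul, Real.norm_eq_abs, Real.norm_eq_abs, ← add_mul, mul_assoc, mul_comm (_ + _)]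
  gcongr

/-- A kernel vector would be an unloaded step from rest, which the stiff bound forces to vanish. -/
theorem eventually_isUnit_stageMatrix_atTop (hA : ∀ j, A 0 j = 0)
    (hker : ∀ x : Fin (s + 1) → ℝ, x 0 = 0 → A *ᵥ x = 0 → x = 0) (hr0 : r 0 = 1)
    (hr : A *ᵥ r = 0) (ξ : ℝ) (hh : 0 < h) :
    ∀ᶠ ω in atTop, IsUnit (stageMatrix A ξ ω h) := by
  obtain ⟨K, hK, hbound⟩ := exists_isStep_stiff_bound (c := 0) hA hker hr0 hr ξ
  filter_upwards [eventually_gt_atTop 0, eventually_ge_atTop (K / h)] with ω hω hωK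
  have hτ : 0 < ω * h := mul_pos hω hh
  have hKτ : K ≤ ω * h := (div_le_iff₀ hh).1 hωK
  rw [← Matrix.mulVec_injective_iff_isUnit]
  refine (injective_iff_map_eq_zero (Matrix.mulVecLin (stageMatrix A ξ ω h))).2 fun X hX => ?_
  have hX' : stageMatrix A ξ ω h *ᵥ Sum.elim (X ∘ Sum.inl) (X ∘ Sum.inr) = 0 := by
    rw [Sum.elim_comp_inl_inr]; exact hX
  have H : IsStep A 0 ξ ω (fun _ => 0) 0 h 0 0 (fun i => 0 + h * (A *ᵥ (X ∘ Sum.inl)) i)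
      (X ∘ Sum.inl) (X ∘ Sum.inr) := by
    refine (isStep_iff hA).2 ⟨?_, rfl⟩
    rw [hX']
    funext i
    rcases i with i | i <;> simp
  have hb := hbound ω h hτ hKτ _ _ _ _ _ H
  set U : Fin (s + 1) → ℝ := fun i => 0 + h * (A *ᵥ (X ∘ Sum.inl)) i
  simp only [mul_zero, zero_smul, sub_zero, abs_zero, add_zero] at hb
  have hsum : ‖ω • U‖ + ‖X ∘ Sum.inl‖ ≤ 0 := nonpos_of_mul_nonpos_right hb hτ
  have hVz : X ∘ Sum.inl = 0 := norm_le_zero_iff.1 (by linarith [norm_nonneg (ω • U)])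
  have hUz : U = 0 := (smul_eq_zero.1 (norm_le_zero_iff.1
    (by linarith [norm_nonneg (X ∘ Sum.inl)] : ‖ω • U‖ ≤ 0))).resolve_left hω.ne'
  have hWz : X ∘ Sum.inr = 0 := by
    funext i
    have := H.equilibrium i
    rw [hVz, hUz] at this
    simpa using this
  rw [← Sum.elim_comp_inl_inr X, hVz, hWz]
  funext i
  rcases i with i | i <;> rfl

/-- The high-frequency limit of the amplification matrix, scaled so that it exists. -/
theorem tendsto_Dnum_atTop (hA : ∀ j, A 0 j = 0)
    (hker : ∀ x : Fin (s + 1) → ℝ, x 0 = 0 → A *ᵥ x = 0 → x = 0) (hr0 : r 0 = 1)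
    (hr : A *ᵥ r = 0) (ξ : ℝ) (hh : 0 < h) :
    Tendsto (fun ω => Dnum A ξ ω h 0 0) atTop (𝓝 (r (Fin.last s))) ∧
    Tendsto (fun ω => ω * Dnum A ξ ω h 0 1) atTop (𝓝 0) ∧
    Tendsto (fun ω => Dnum A ξ ω h 1 0 / ω) atTop (𝓝 0) ∧
    Tendsto (fun ω => Dnum A ξ ω h 1 1) atTop (𝓝 (r (Fin.last s))) := by
  obtain ⟨K, hK, hbound⟩ := exists_isStep_stiff_bound (c := 0) hA hker hr0 hr ξ
  -- The initial data `(1/ω, 0)` and `(0, 1)` are normalised in this sense and give the two columns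
  -- of the rescaled matrix.
  have hev : ∀ᶠ ω in atTop, 0 < ω ∧ ∀ un vn : ℝ, |ω * un| + |vn| = 1 →
      |ω * (Dnum A ξ ω h *ᵥ ![un, vn]) 0 - ω * un * r (Fin.last s)| ≤ K / h / ω ∧
      |(Dnum A ξ ω h *ᵥ ![un, vn]) 1 - vn * r (Fin.last s)| ≤ K / h / ω := by
    filter_upwards [eventually_gt_atTop 0, eventually_ge_atTop (K / h),
      eventually_isUnit_stageMatrix_atTop hA hker hr0 hr ξ hh] with ω hω hωK hS
    refine ⟨hω, fun un vn hy => ?_⟩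
    have hτ : 0 < ω * h := mul_pos hω hh
    have hKτ : K ≤ ω * h := (div_le_iff₀ hh).1 hωK
    obtain ⟨⟨U, V, W⟩, H⟩ := (existsUnique_isStep (c := 0) (f := fun _ => 0) (tn := 0)
      (un := un) (vn := vn) hA hS).exists
    have hb := hbound ω h hτ hKτ _ _ _ _ _ H
    have hend := H.end_eq hA hS
    have e1 : (Sum.elim (fun _ => 0) (fun _ => 0) : Fin (s + 1) ⊕ Fin (s + 1) → ℝ) = 0 := by
      funext x; rcases x with x | x <;> rfl
    rw [e1, Matrix.mulVec_zero, add_zero] at hend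
    rw [← hend]
    dsimp only at hb ⊢
    rw [hy, mul_one, mul_comm, ← le_div_iff₀ hτ, mul_comm ω h, ← div_div] at hb
    have n1 := norm_le_pi_norm (ω • U - (ω * un) • r) (Fin.last s)
    have n2 := norm_le_pi_norm (V - vn • r) (Fin.last s)
    have p1 := norm_nonneg (ω • U - (ω * un) • r)
    have p2 := norm_nonneg (V - vn • r)
    simp only [Pi.sub_apply, Pi.smul_apply, smul_eq_mul, Real.norm_eq_abs] at n1 n2
    constructor
    · change |ω * U (Fin.last s) - ω * un * r (Fin.last s)| ≤ _
      linarith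
    · change |V (Fin.last s) - vn * r (Fin.last s)| ≤ _
      linarith
  have hlim : Tendsto (fun ω : ℝ => K / h / ω) atTop (𝓝 0) := tendsto_const_nhds.div_atTop tendsto_id
  have squeeze : ∀ {y : ℝ → ℝ} {l : ℝ}, (∀ᶠ ω in atTop, |y ω - l| ≤ K / h / ω) →
      Tendsto y atTop (𝓝 l) := fun hy =>
    tendsto_sub_nhds_zero_iff.1 (squeeze_zero_norm' hy hlim)
  refine ⟨squeeze ?_, squeeze ?_, squeeze ?_, squeeze ?_⟩
  · filter_upwards [hev] with ω ⟨hω, hb⟩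
    have := (hb (1 / ω) 0 (by simp [hω.ne'])).1
    have e : ω * (Dnum A ξ ω h *ᵥ ![1 / ω, 0]) 0 - ω * (1 / ω) * r (Fin.last s) =
        Dnum A ξ ω h 0 0 - r (Fin.last s) := by
      simp [Matrix.mulVec, dotProduct, Fin.sum_univ_two]
      field_simp
    rwa [e] at this
  · filter_upwards [hev] with ω ⟨hω, hb⟩
    have := (hb 0 1 (by simp)).1
    simpa [Matrix.mulVec, dotProduct, Fin.sum_univ_two] using this
  · filter_upwards [hev] with ω ⟨hω, hb⟩
    have := (hb (1 / ω) 0 (by simp [hω.ne'])).2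
    simpa [Matrix.mulVec, dotProduct, Fin.sum_univ_two, div_eq_mul_inv] using this
  · filter_upwards [hev] with ω ⟨hω, hb⟩
    have := (hb 0 1 (by simp)).2
    simpa [Matrix.mulVec, dotProduct, Fin.sum_univ_two] using this

theorem hasHighFreqDoubleEigenvalue_of_kernel (hA : ∀ j, A 0 j = 0)
    (hker : ∀ x : Fin (s + 1) → ℝ, x 0 = 0 → A *ᵥ x = 0 → x = 0) (hr0 : r 0 = 1)
    (hr : A *ᵥ r = 0) (ξ : ℝ) (hh : 0 < h) :
    HasHighFreqDoubleEigenvalue A ξ h (r (Fin.last s)) := by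
  refine ⟨eventually_isUnit_stageMatrix_atTop hA hker hr0 hr ξ hh, fun k => ?_⟩
  obtain ⟨h00, h01, h10, h11⟩ := tendsto_Dnum_atTop hA hker hr0 hr ξ hh
  set ρ := r (Fin.last s)
  have htr : Tendsto (fun ω => (Dnum A ξ ω h).trace) atTop (𝓝 (ρ + ρ)) := by
    simp only [Matrix.trace_fin_two]
    exact h00.add h11
  have hdet : Tendsto (fun ω => (Dnum A ξ ω h).det) atTop (𝓝 (ρ * ρ - 0 * 0)) := by
    -- The factors `ω` and `1/ω` on the off-diagonal entries cancel in the determinant.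
    refine ((h00.mul h11).sub (h01.mul h10)).congr' ?_
    filter_upwards [eventually_gt_atTop 0] with ω hω
    rw [Matrix.det_fin_two]
    field_simp
  have hpoly : ∀ a b : ℝ, (Polynomial.X ^ 2 - Polynomial.C a * Polynomial.X + Polynomial.C b).coeff k
      = (Polynomial.X ^ 2 : Polynomial ℝ).coeff k - a * (Polynomial.X : Polynomial ℝ).coeff k
        + b * (1 : Polynomial ℝ).coeff k := fun a b => by
    rw [Polynomial.coeff_add, Polynomial.coeff_sub, Polynomial.coeff_C_mul,
      ← mul_one (Polynomial.C b), Polynomial.coeff_C_mul]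
  have hsq : (Polynomial.X - Polynomial.C ρ) ^ 2 =
      Polynomial.X ^ 2 - Polynomial.C (ρ + ρ) * Polynomial.X + Polynomial.C (ρ * ρ - 0 * 0) := by
    simp only [Polynomial.C_add, Polynomial.C_mul, mul_zero, sub_zero]
    ring
  rw [hsq, hpoly]
  simp only [Matrix.charpoly_fin_two, hpoly]
  exact (tendsto_const_nhds.sub (htr.mul_const _)).add (hdet.mul_const _)

theorem HasHighFreqDoubleEigenvalue.unique {r₁ r₂ : ℝ}
    (h₁ : HasHighFreqDoubleEigenvalue A ξ h r₁) (h₂ : HasHighFreqDoubleEigenvalue A ξ h r₂) :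
    r₁ = r₂ := by
  have hc : ∀ r : ℝ, ((Polynomial.X - Polynomial.C r) ^ 2).coeff 1 = -2 * r := fun r => by
    have e : (Polynomial.X - Polynomial.C r) ^ 2 =
        Polynomial.X ^ 2 - Polynomial.C (2 * r) * Polynomial.X + Polynomial.C (r ^ 2) := by
      simp only [Polynomial.C_mul, Polynomial.C_pow, map_ofNat]
      ring
    rw [e]
    simp [Polynomial.coeff_X_pow, Polynomial.coeff_C, -map_pow]
  have := tendsto_nhds_unique (h₁.2 1) (h₂.2 1)
  rw [hc, hc] at this
  linarith

/-! ### Schemes with a constant nonzero diagonal -/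

section Diagonal

variable {g : ℝ}

theorem eq_zero_of_mulVec_eq_zero (htri : ∀ i j, i < j → A i j = 0)
    (hdiag : ∀ i, i ≠ 0 → A i i ≠ 0) (x : Fin (s + 1) → ℝ) (hx0 : x 0 = 0)
    (hx : A *ᵥ x = 0) : x = 0 := by
  have key : ∀ i, x i = 0 := by
    intro i
    induction i using WellFoundedLT.induction with
    | _ i ih =>
      by_cases hi : i = 0
      · rw [hi, hx0]
      · have h1 : ∑ j, A i j * x j = 0 := congrFun hx i
        rw [Finset.sum_eq_single i] at h1
        · exact (mul_eq_zero.1 h1).resolve_left (hdiag i hi)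
        · intro j _ hj
          rcases lt_or_gt_of_ne hj with hj | hj
          · rw [ih j hj, mul_zero]
          · rw [htri i j hj, zero_mul]
        · simp
  exact funext key

theorem mul_sub_smul_one_pow_eq_zero (htri : ∀ i j, i < j → A i j = 0) (hA : A 0 0 = 0)
    (hdiag : ∀ i, i ≠ 0 → A i i = g) : A * (A - g • 1) ^ s = 0 := by
  have hchar : A.charpoly = Polynomial.X * (Polynomial.X - Polynomial.C g) ^ s := by
    rw [← Matrix.charpoly_transpose, Matrix.charpoly_of_isUpperTriangular Aᵀ
      (fun i j hij => htri j i hij), Fin.prod_univ_succ]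
    simp [hA, hdiag]
  have h := Matrix.aeval_self_charpoly A
  rw [hchar] at h
  simpa [Algebra.algebraMap_eq_smul_one] using h

theorem sub_smul_one_pow_mulVec_zero (hA : ∀ j, A 0 j = 0) (n : ℕ) (x : Fin (s + 1) → ℝ) :
    ((A - g • 1) ^ n *ᵥ x) 0 = (-g) ^ n * x 0 := by
  induction n with
  | zero => simp
  | succ n ih =>
    rw [pow_succ', ← Matrix.mulVec_mulVec, Matrix.sub_mulVec, Matrix.smul_mulVec,
      Matrix.one_mulVec, Pi.sub_apply, Pi.smul_apply, ih, Matrix.mulVec, dotProduct]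
    simp [hA]
    ring

/-- Binomial expansion with `(A^m 1)_last = 1/m!` for `m ≤ 5`. The expansion is made in `ℝ[X]` and
transported by `aeval A`. -/
theorem OrderFive.sub_smul_one_pow_mulVec_last {A : Matrix (Fin (s + 1)) (Fin (s + 1)) ℝ}
    (H : OrderFive A c) (g : ℝ) :
    ((A - g • 1) ^ 5 *ᵥ fun _ => 1) (Fin.last s) =
      1 / 120 - 5 / 24 * g + 5 / 3 * g ^ 2 - 5 * g ^ 3 + 5 * g ^ 4 - g ^ 5 := by
  have hpow : (A - g • 1) ^ 5 = A ^ 5 - (5 * g) • A ^ 4 + (10 * g ^ 2) • A ^ 3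
      - (10 * g ^ 3) • A ^ 2 + (5 * g ^ 4) • A - g ^ 5 • 1 := by
    have hexp : ∀ a₁ a₂ a₃ a₄ a₅ : ℝ, Polynomial.aeval A (Polynomial.X ^ 5
        - Polynomial.C a₁ * Polynomial.X ^ 4 + Polynomial.C a₂ * Polynomial.X ^ 3
        - Polynomial.C a₃ * Polynomial.X ^ 2 + Polynomial.C a₄ * Polynomial.X - Polynomial.C a₅) =
        A ^ 5 - a₁ • A ^ 4 + a₂ • A ^ 3 - a₃ • A ^ 2 + a₄ • A - a₅ • 1 := by
      intros
      simp [Algebra.algebraMap_eq_smul_one]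
    have h := congrArg (Polynomial.aeval A) (show (Polynomial.X - Polynomial.C g) ^ 5 =
      Polynomial.X ^ 5 - Polynomial.C (5 * g) * Polynomial.X ^ 4
      + Polynomial.C (10 * g ^ 2) * Polynomial.X ^ 3 - Polynomial.C (10 * g ^ 3) * Polynomial.X ^ 2
      + Polynomial.C (5 * g ^ 4) * Polynomial.X - Polynomial.C (g ^ 5) by
        simp only [Polynomial.C_mul, Polynomial.C_pow, map_ofNat]
        ring)
    rw [hexp] at h
    simpa [Algebra.algebraMap_eq_smul_one] using h
  have h1 : (A *ᵥ fun _ => 1) = c := funext H.stage_zero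
  have h2 : A *ᵥ c = (1 / 2 : ℝ) • fun j => c j ^ 2 := funext fun i => by
    rw [H.stage_one]; simp; ring
  have e1 : (A *ᵥ fun _ => 1) (Fin.last s) = 1 := by rw [h1, H.node_last]
  have e2 : (A ^ 2 *ᵥ fun _ => 1) (Fin.last s) = 1 / 2 := by
    rw [pow_two, ← Matrix.mulVec_mulVec, h1, H.stage_one, H.node_last]; norm_num
  have e3 : (A ^ 3 *ᵥ fun _ => 1) (Fin.last s) = 1 / 6 := by
    rw [pow_succ', pow_two, ← Matrix.mulVec_mulVec, ← Matrix.mulVec_mulVec, h1, h2,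
      Matrix.mulVec_smul, Pi.smul_apply, H.moment_two]; norm_num
  have e4 : (A ^ 4 *ᵥ fun _ => 1) (Fin.last s) = 1 / 24 := by
    rw [pow_succ', pow_succ', pow_two, ← Matrix.mulVec_mulVec, ← Matrix.mulVec_mulVec,
      ← Matrix.mulVec_mulVec, h1, h2, Matrix.mulVec_smul, Matrix.mulVec_smul, Pi.smul_apply,
      H.iterated_two]; norm_num
  have e5 : (A ^ 5 *ᵥ fun _ => 1) (Fin.last s) = 1 / 120 := by
    rw [pow_succ', pow_succ', pow_succ', pow_two, ← Matrix.mulVec_mulVec, ← Matrix.mulVec_mulVec,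
      ← Matrix.mulVec_mulVec, ← Matrix.mulVec_mulVec, h1, h2, Matrix.mulVec_smul,
      Matrix.mulVec_smul, Matrix.mulVec_smul, Pi.smul_apply, H.twice_iterated_two]; norm_num
  rw [hpow]
  simp only [Matrix.sub_mulVec, Matrix.add_mulVec, Matrix.smul_mulVec, Matrix.one_mulVec,
    Pi.sub_apply, Pi.add_apply, Pi.smul_apply, smul_eq_mul, e1, e2, e3, e4, e5]
  ring

/-- The high-frequency limit of a fifth-order scheme with five sub-steps. -/
theorem OrderFive.hasHighFreqDoubleEigenvalue {A : Matrix (Fin 6) (Fin 6) ℝ} {c : Fin 6 → ℝ}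
    (H : OrderFive (s := 5) A c) (htri : ∀ i j, i < j → A i j = 0)
    (hdiag : ∀ i, i ≠ 0 → A i i = g) (hg : g ≠ 0) (ξ : ℝ) (hh : 0 < h) :
    HasHighFreqDoubleEigenvalue (s := 5) A ξ h
      ((1 / 120 - 5 / 24 * g + 5 / 3 * g ^ 2 - 5 * g ^ 3 + 5 * g ^ 4 - g ^ 5) / (-g) ^ 5) := by
  have hg5 : (-g) ^ 5 ≠ 0 := pow_ne_zero _ (neg_ne_zero.2 hg)
  -- Entry 0 of `(A - g)^5 1` is `(-g)^5`, because row 0 of `A` vanishes; this fixes the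
  -- normalisation of `r`.
  have key := hasHighFreqDoubleEigenvalue_of_kernel (s := 5) (A := A)
    (r := ((-g) ^ 5)⁻¹ • ((A - g • 1) ^ 5 *ᵥ fun _ => 1)) H.row_zero
    (eq_zero_of_mulVec_eq_zero (s := 5) htri fun i hi => by rw [hdiag i hi]; exact hg)
    (by
      rw [Pi.smul_apply, sub_smul_one_pow_mulVec_zero (s := 5) H.row_zero, mul_one, smul_eq_mul,
        inv_mul_cancel₀ hg5])
    (by
      rw [Matrix.mulVec_smul, Matrix.mulVec_mulVec,
        mul_sub_smul_one_pow_eq_zero (s := 5) htri (H.row_zero 0) hdiag, Matrix.zero_mulVec,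
        smul_zero]) ξ hh
  rwa [Pi.smul_apply, H.sub_smul_one_pow_mulVec_last, smul_eq_mul, inv_mul_eq_div] at key

end Diagonal

end SubStep

namespace SUCI5

open Matrix SubStep

/-! ### The coefficients of the scheme satisfy the fifth-order conditions -/

variable {g1 g2 g3 g4 : ℝ}

theorem mulVec_eq (g1 g2 g3 g4 : ℝ) (x : Fin 6 → ℝ) :
    A g1 g2 g3 g4 *ᵥ x = ![0,
      g1 / 2 * x 0 + g1 / 2 * x 1,
      a20 g1 g2 * x 0 + a21 g1 g2 * x 1 + g1 / 2 * x 2,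
      a30 g1 g2 g3 g4 * x 0 + a31 g1 g2 g3 g4 * x 1 + a32 g1 g2 g3 g4 * x 2 + g1 / 2 * x 3,
      a40 g1 g2 g3 g4 * x 0 + a41 g1 g2 g3 g4 * x 1 + a42 g1 g2 g3 g4 * x 2
        + a43 g1 g2 g3 g4 * x 3 + g1 / 2 * x 4,
      a50 g1 g2 g3 g4 * x 0 + a51 g1 g2 g3 g4 * x 1 + a52 g1 g2 g3 g4 * x 2
        + a53 g1 g2 g3 g4 * x 3 + a54 g1 g2 g3 g4 * x 4 + g1 / 2 * x 5] := by
  funext i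
  fin_cases i <;> simp [A, Matrix.mulVec, dotProduct, Fin.sum_univ_succ] <;> ring

/-- In each row `α_i0` and `α_i1` are chosen to satisfy this condition and the next one. -/
theorem mulVec_one (h1 : g1 ≠ 0) (i : Fin 6) :
    (A g1 g2 g3 g4 *ᵥ fun _ => 1) i = nodes g1 g2 g3 g4 i := by
  rw [mulVec_eq]
  fin_cases i <;> simp [nodes, a20, a21, a30, a31, a40, a41, a50, a51] <;> field_simp <;> ring

theorem mulVec_nodes (h1 : g1 ≠ 0) (i : Fin 6) :
    (A g1 g2 g3 g4 *ᵥ nodes g1 g2 g3 g4) i = nodes g1 g2 g3 g4 i ^ 2 / 2 := by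
  rw [mulVec_eq]
  fin_cases i <;> simp [nodes, a21, a31, a41, a51] <;> field_simp <;> ring

/-! ### Definitions of the coefficients with denominators cleared -/

theorem mul_a52 (H : Admissible g1 g2 g3 g4) :
    6 * g2 * (g2 - g1) * a52 g1 g2 g3 g4 + 6 * g3 * (g3 - g1) * a53 g1 g2 g3 g4
      + 6 * g4 * (g4 - g1) * a54 g1 g2 g3 g4 = 3 * g1 ^ 2 - 6 * g1 + 2 := by
  have h2 := H.g2_ne
  have h12 := sub_ne_zero.2 H.g12.symm
  simp only [a52]
  field_simp
  ring

/-- `G(x)` is 60 times `∫₀¹ p - (γ1/2) p(1)` for `p(t) = t (t - γ1)(t - γ2)(t - x)`. With `x = γ4`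
the only other node where `p` need not vanish is `γ3`, which isolates `α53`; `x = γ3` isolates
`α54`. -/
theorem mul_a53 (H : Admissible g1 g2 g3 g4) :
    60 * g3 * (g3 - g4) * (g3 - g2) * (g3 - g1) * a53 g1 g2 g3 g4 = G g1 g2 g4 := by
  have h3 := H.g3_ne
  have h34 := sub_ne_zero.2 H.g34
  have h23 := sub_ne_zero.2 H.g23
  have h13 := sub_ne_zero.2 H.g13
  simp only [a53]
  field_simp
  ring

theorem mul_a54 (H : Admissible g1 g2 g3 g4) :
    60 * g4 * (g4 - g3) * (g4 - g2) * (g4 - g1) * a54 g1 g2 g3 g4 = G g1 g2 g3 := by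
  have h4 := H.g4_ne
  have h34 := sub_ne_zero.2 H.g34.symm
  have h24 := sub_ne_zero.2 H.g24.symm
  have h14 := sub_ne_zero.2 H.g14.symm
  simp only [a54]
  field_simp

theorem a54_ne (H : Admissible g1 g2 g3 g4) : a54 g1 g2 g3 g4 ≠ 0 := fun h =>
  H.G_ne (by rw [← mul_a54 H, h, mul_zero])

/-- Only the product matters for the order conditions, and `G(γ3)` cancels from it. `N` is what the
condition on `A²` leaves for `t (t - γ1)(t - γ2)`, times 60, once the diagonal contributions are
removed using the moments. -/
theorem a43_mul_a54 (H : Admissible g1 g2 g3 g4) :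
    60 * g3 * (g3 - g1) * (g3 - g2) * (a43 g1 g2 g3 g4 * a54 g1 g2 g3 g4) = N g1 g2 := by
  have h3 := H.g3_ne
  have h4 := H.g4_ne
  have h23 := sub_ne_zero.2 H.g23.symm
  have h13 := sub_ne_zero.2 H.g13.symm
  have h34 := sub_ne_zero.2 H.g34.symm
  have h24 := sub_ne_zero.2 H.g24.symm
  have h14 := sub_ne_zero.2 H.g14.symm
  have hG := H.G_ne
  simp only [a43, a54]
  field_simp

theorem a43_mul_a54_ne (H : Admissible g1 g2 g3 g4) :
    a43 g1 g2 g3 g4 * a54 g1 g2 g3 g4 ≠ 0 := fun h =>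
  H.N_ne (by rw [← a43_mul_a54 H, h, mul_zero])

theorem mul_a32 (H : Admissible g1 g2 g3 g4) :
    120 * g2 * (g2 - g1) * (a43 g1 g2 g3 g4 * a54 g1 g2 g3 g4) * a32 g1 g2 g3 g4 =
      15 * g1 ^ 4 - 60 * g1 ^ 3 + 60 * g1 ^ 2 - 20 * g1 + 2 := by
  have h2 := H.g2_ne
  have h12 := sub_ne_zero.2 H.g12.symm
  have h43 := left_ne_zero_of_mul (a43_mul_a54_ne H)
  have h54 := a54_ne H
  simp only [a32]
  field_simp

/-- The definition of `a42`, combined with that of `a32`. -/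
theorem mul_a42 (H : Admissible g1 g2 g3 g4) :
    6 * g2 * (g2 - g1) * (a53 g1 g2 g3 g4 * a32 g1 g2 g3 g4 + a54 g1 g2 g3 g4 * a42 g1 g2 g3 g4)
      + 6 * g3 * (g3 - g1) * (a43 g1 g2 g3 g4 * a54 g1 g2 g3 g4) =
      (-30 * g1 ^ 3 + 90 * g1 ^ 2 - 60 * g1 + 10) / 20 := by
  have h2 := H.g2_ne
  have h12 := sub_ne_zero.2 H.g12
  have h43 := left_ne_zero_of_mul (a43_mul_a54_ne H)
  have h54 := a54_ne H
  have e32 := mul_a32 H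
  have e42 : 120 * a43 g1 g2 g3 g4 * a54 g1 g2 g3 g4 ^ 2 * g2 * (g1 - g2) * a42 g1 g2 g3 g4 =
      15 * a53 g1 g2 g3 g4 * g1 ^ 4
      + 30 * (a43 g1 g2 g3 g4 * a54 g1 g2 g3 g4 - 2 * a53 g1 g2 g3 g4) * g1 ^ 3
      + 30 * (2 * a53 g1 g2 g3 g4 - 3 * a43 g1 g2 g3 g4 * a54 g1 g2 g3 g4) * g1 ^ 2
      + 20 * (-6 * a43 g1 g2 g3 g4 ^ 2 * a54 g1 g2 g3 g4 ^ 2 * g3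
        + 3 * a43 g1 g2 g3 g4 * a54 g1 g2 g3 g4 - a53 g1 g2 g3 g4) * g1
      + 120 * a43 g1 g2 g3 g4 ^ 2 * a54 g1 g2 g3 g4 ^ 2 * g3 ^ 2
      - 10 * a43 g1 g2 g3 g4 * a54 g1 g2 g3 g4 + 2 * a53 g1 g2 g3 g4 := by
    simp only [a42]
    field_simp
  -- The definition of `α42` has `α32` already eliminated; multiplying by `α43 α54` allows it to be
  -- put back.
  refine mul_left_cancel₀ (a43_mul_a54_ne H) ?_
  linear_combination a53 g1 g2 g3 g4 / 20 * e32 - e42 / 20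

/-! ### Powers of the nodes and the order conditions -/

/-- Writing `t² = t (t - γ1) + γ1 t` and using `A c = c²/2` removes the first two columns. The rows
are left in this form to match the cleared definitions. -/
theorem mulVec_sq (h1 : g1 ≠ 0) :
    A g1 g2 g3 g4 *ᵥ (fun j => nodes g1 g2 g3 g4 j ^ 2) = ![0, g1 ^ 3 / 2,
      -g1 ^ 2 * g2 / 2 + g1 * g2 ^ 2,
      -g1 ^ 2 * g3 / 2 + g1 * g3 ^ 2 + a32 g1 g2 g3 g4 * (g2 * (g2 - g1)),
      -g1 ^ 2 * g4 / 2 + g1 * g4 ^ 2 + a42 g1 g2 g3 g4 * (g2 * (g2 - g1))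
        + a43 g1 g2 g3 g4 * (g3 * (g3 - g1)),
      -g1 ^ 2 / 2 + g1 + a52 g1 g2 g3 g4 * (g2 * (g2 - g1))
        + a53 g1 g2 g3 g4 * (g3 * (g3 - g1)) + a54 g1 g2 g3 g4 * (g4 * (g4 - g1))] := by
  rw [mulVec_eq]
  funext i
  fin_cases i <;> simp [nodes, a21, a31, a41, a51] <;> field_simp <;> ring

theorem mulVec_cube (h1 : g1 ≠ 0) :
    A g1 g2 g3 g4 *ᵥ (fun j => nodes g1 g2 g3 g4 j ^ 3) = ![0, g1 ^ 4 / 2,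
      g2 * (g2 - g1) * g1 ^ 2 / 2 + g1 * g2 ^ 3 / 2,
      g3 * (g3 - g1) * g1 ^ 2 / 2 + g1 * g3 ^ 3 / 2
        + a32 g1 g2 g3 g4 * (g2 * (g2 ^ 2 - g1 ^ 2)),
      g4 * (g4 - g1) * g1 ^ 2 / 2 + g1 * g4 ^ 3 / 2
        + a42 g1 g2 g3 g4 * (g2 * (g2 ^ 2 - g1 ^ 2))
        + a43 g1 g2 g3 g4 * (g3 * (g3 ^ 2 - g1 ^ 2)),
      (1 - g1) * g1 ^ 2 / 2 + g1 / 2 + a52 g1 g2 g3 g4 * (g2 * (g2 ^ 2 - g1 ^ 2))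
        + a53 g1 g2 g3 g4 * (g3 * (g3 ^ 2 - g1 ^ 2))
        + a54 g1 g2 g3 g4 * (g4 * (g4 ^ 2 - g1 ^ 2))] := by
  rw [mulVec_eq]
  funext i
  fin_cases i <;> simp [nodes, a21, a31, a41, a51] <;> field_simp <;> ring

theorem moment_two (H : Admissible g1 g2 g3 g4) :
    (A g1 g2 g3 g4 *ᵥ fun j => nodes g1 g2 g3 g4 j ^ 2) 5 = 1 / 3 := by
  rw [mulVec_sq H.g1_ne]
  change -g1 ^ 2 / 2 + g1 + a52 g1 g2 g3 g4 * (g2 * (g2 - g1))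
        + a53 g1 g2 g3 g4 * (g3 * (g3 - g1)) + a54 g1 g2 g3 g4 * (g4 * (g4 - g1)) = 1 / 3
  linear_combination mul_a52 H / 6

theorem moment_three (H : Admissible g1 g2 g3 g4) :
    (A g1 g2 g3 g4 *ᵥ fun j => nodes g1 g2 g3 g4 j ^ 3) 5 = 1 / 4 := by
  rw [mulVec_cube H.g1_ne]
  change (1 - g1) * g1 ^ 2 / 2 + g1 / 2 + a52 g1 g2 g3 g4 * (g2 * (g2 ^ 2 - g1 ^ 2))
        + a53 g1 g2 g3 g4 * (g3 * (g3 ^ 2 - g1 ^ 2))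
        + a54 g1 g2 g3 g4 * (g4 * (g4 ^ 2 - g1 ^ 2)) = 1 / 4
  have h34 := sub_ne_zero.2 H.g34
  have e3 : g3 * (g3 - g1) * (g3 - g2) * a53 g1 g2 g3 g4 = G g1 g2 g4 / (60 * (g3 - g4)) := by
    rw [← mul_a53 H]; field_simp
  have e4 : g4 * (g4 - g1) * (g4 - g2) * a54 g1 g2 g3 g4 = -G g1 g2 g3 / (60 * (g3 - g4)) := by
    rw [← mul_a54 H]; field_simp; ring
  have e5 : G g1 g2 g4 / (60 * (g3 - g4)) + -G g1 g2 g3 / (60 * (g3 - g4)) =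
      (30 * (1 - g2) * g1 ^ 2 + (-50 + 60 * g2) * g1 - 20 * g2 + 15) / 60 := by
    simp only [G]
    field_simp
    ring
  -- From `t² - γ1² = (t - γ1)((t - γ2) + (γ1 + γ2))`. As `G` is affine in its last argument, `e5`
  -- is its slope.
  linear_combination (g1 + g2) * mul_a52 H / 6 + e3 + e4 + e5

theorem moment_four (H : Admissible g1 g2 g3 g4) :
    (A g1 g2 g3 g4 *ᵥ fun j => nodes g1 g2 g3 g4 j ^ 4) 5 = 1 / 5 := by
  have h1 := H.g1_ne
  have e : (A g1 g2 g3 g4 *ᵥ fun j => nodes g1 g2 g3 g4 j ^ 4) 5 =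
      (1 - g1) * g1 ^ 3 / 2 + g1 / 2 + a52 g1 g2 g3 g4 * (g2 * (g2 ^ 3 - g1 ^ 3))
        + a53 g1 g2 g3 g4 * (g3 * (g3 ^ 3 - g1 ^ 3))
        + a54 g1 g2 g3 g4 * (g4 * (g4 ^ 3 - g1 ^ 3)) := by
    rw [mulVec_eq]
    simp [nodes, a51]
    field_simp
    ring
  rw [e]
  have h34 := sub_ne_zero.2 H.g34
  have e3 : g3 * (g3 - g1) * (g3 - g2) * a53 g1 g2 g3 g4 = G g1 g2 g4 / (60 * (g3 - g4)) := by
    rw [← mul_a53 H]; field_simp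
  have e4 : g4 * (g4 - g1) * (g4 - g2) * a54 g1 g2 g3 g4 = -G g1 g2 g3 / (60 * (g3 - g4)) := by
    rw [← mul_a54 H]; field_simp; ring
  have e5 : G g1 g2 g4 / (60 * (g3 - g4)) * (g3 + g2 + g1)
      + -G g1 g2 g3 / (60 * (g3 - g4)) * (g4 + g2 + g1) =
      (30 * (1 - g2) * g1 ^ 2 + (-45 + 50 * g2) * g1 - 15 * g2 + 12
        - (g1 + g2) * (-30 * (1 - g2) * g1 ^ 2 + (50 - 60 * g2) * g1 + 20 * g2 - 15)) / 60 := by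
    simp only [G]
    field_simp
    ring
  -- From `t² + γ1 t + γ1² = (t - γ2)(t + γ1 + γ2) + γ1² + γ1 γ2 + γ2²`.
  linear_combination (g1 ^ 2 + g1 * g2 + g2 ^ 2) * mul_a52 H / 6 + (g3 + g2 + g1) * e3
    + (g4 + g2 + g1) * e4 + e5

theorem mulVec_mulVec_sq (H : Admissible g1 g2 g3 g4) :
    A g1 g2 g3 g4 *ᵥ A g1 g2 g3 g4 *ᵥ (fun j => nodes g1 g2 g3 g4 j ^ 2) = ![0, g1 ^ 4 / 4,
      3 / 4 * g1 ^ 2 * (g2 * (g2 - g1)) + g1 ^ 3 * g2 / 4,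
      3 / 4 * g1 ^ 2 * (g3 * (g3 - g1)) + g1 ^ 3 * g3 / 4
        + 3 / 2 * g1 * (a32 g1 g2 g3 g4 * (g2 * (g2 - g1))),
      3 / 4 * g1 ^ 2 * (g4 * (g4 - g1)) + g1 ^ 3 * g4 / 4
        + 3 / 2 * g1 * (a42 g1 g2 g3 g4 * (g2 * (g2 - g1))
          + a43 g1 g2 g3 g4 * (g3 * (g3 - g1)))
        + a43 g1 g2 g3 g4 * (a32 g1 g2 g3 g4 * (g2 * (g2 - g1))),
      1 / 12] := by
  have h1 := H.g1_ne
  rw [mulVec_sq h1, mulVec_eq]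
  funext i
  fin_cases i
  · simp
  · simp; ring
  · simp [a21]; field_simp; ring
  · simp [a31]; field_simp; ring
  · simp [a41]; field_simp; ring
  · have e : g1 * a51 g1 g2 g3 g4 = (1 - g1) / 2 - a52 g1 g2 g3 g4 * g2
        - a53 g1 g2 g3 g4 * g3 - a54 g1 g2 g3 g4 * g4 := by
      simp only [a51]; field_simp; ring
    simp
    linear_combination g1 ^ 2 / 2 * e + (3 / 2 * g1) * mul_a52 H / 6 + mul_a42 H / 6

theorem iterated_two (H : Admissible g1 g2 g3 g4) :
    (A g1 g2 g3 g4 *ᵥ A g1 g2 g3 g4 *ᵥ fun j => nodes g1 g2 g3 g4 j ^ 2) 5 = 1 / 12 := by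
  rw [mulVec_mulVec_sq H]
  rfl

theorem iterated_three (H : Admissible g1 g2 g3 g4) :
    (A g1 g2 g3 g4 *ᵥ A g1 g2 g3 g4 *ᵥ fun j => nodes g1 g2 g3 g4 j ^ 3) 5 = 1 / 20 := by
  have h1 := H.g1_ne
  have e : g1 * a51 g1 g2 g3 g4 = (1 - g1) / 2 - a52 g1 g2 g3 g4 * g2
      - a53 g1 g2 g3 g4 * g3 - a54 g1 g2 g3 g4 * g4 := by
    simp only [a51]; field_simp; ring
  have e3 := moment_three H
  have e4 := a43_mul_a54 H
  rw [mulVec_cube h1] at e3 ⊢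
  rw [mulVec_eq]
  simp only [N] at e4
  simp at e3 ⊢
  linear_combination g1 ^ 3 / 2 * e + g1 * e3 + g1 ^ 2 / 2 * mul_a52 H / 6
    + (g1 + g2) * mul_a42 H / 6 + e4 / 60

theorem twice_iterated_two (H : Admissible g1 g2 g3 g4) :
    (A g1 g2 g3 g4 *ᵥ A g1 g2 g3 g4 *ᵥ A g1 g2 g3 g4 *ᵥ
      fun j => nodes g1 g2 g3 g4 j ^ 2) 5 = 1 / 60 := by
  have h1 := H.g1_ne
  have e : g1 * a51 g1 g2 g3 g4 = (1 - g1) / 2 - a52 g1 g2 g3 g4 * g2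
      - a53 g1 g2 g3 g4 * g3 - a54 g1 g2 g3 g4 * g4 := by
    simp only [a51]; field_simp; ring
  rw [mulVec_mulVec_sq H, mulVec_eq]
  simp
  linear_combination g1 ^ 3 / 4 * e + 3 / 4 * g1 ^ 2 * mul_a52 H / 6
    + 3 / 2 * g1 * mul_a42 H / 6 + mul_a32 H / 120

theorem orderFive (H : Admissible g1 g2 g3 g4) :
    OrderFive (s := 5) (A g1 g2 g3 g4) (nodes g1 g2 g3 g4) where
  row_zero j := by fin_cases j <;> rfl
  node_last := rfl
  stage_zero := mulVec_one H.g1_ne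
  stage_one := mulVec_nodes H.g1_ne
  moment_two := moment_two H
  moment_three := moment_three H
  moment_four := moment_four H
  iterated_two := iterated_two H
  iterated_three := iterated_three H
  twice_iterated_two := twice_iterated_two H

/-! ### High-frequency limit of the five-sub-step scheme -/

theorem A_apply_eq_zero (g1 g2 g3 g4 : ℝ) (i j : Fin 6) (hij : i < j) : A g1 g2 g3 g4 i j = 0 := by
  fin_cases i <;> fin_cases j <;> first | rfl | exact absurd hij (by decide)

theorem A_diag (g1 g2 g3 g4 : ℝ) (i : Fin 6) (hi : i ≠ 0) : A g1 g2 g3 g4 i i = g1 / 2 := by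
  fin_cases i <;> first | rfl | exact absurd rfl hi

theorem hasHighFreqDoubleEigenvalue (H : Admissible g1 g2 g3 g4) (ξ : ℝ) {h : ℝ} (hh : 0 < h) :
    HasHighFreqDoubleEigenvalue (s := 5) (A g1 g2 g3 g4) ξ h (rhoInf g1) := by
  have h1 := H.g1_ne
  have key := (orderFive H).hasHighFreqDoubleEigenvalue (A_apply_eq_zero g1 g2 g3 g4)
    (A_diag g1 g2 g3 g4) (div_ne_zero h1 two_ne_zero) ξ hh
  convert key using 1
  rw [rhoInf]
  field_simp
  ring

end SUCI5

end

theorem mainTheorem3 (g1 g2 g3 g4 : ℝ) (hg : SUCI5.Admissible g1 g2 g3 g4) :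
    SubStep.LocallyAccurate 5 (SUCI5.A g1 g2 g3 g4) (SUCI5.nodes g1 g2 g3 g4) ∧
    SubStep.OperatorAccurate 5 (SUCI5.A g1 g2 g3 g4) (SUCI5.nodes g1 g2 g3 g4) ∧
    ∀ ξ h : ℝ, 0 < h → ∀ ρ : ℝ,
      (SubStep.HasHighFreqDoubleEigenvalue (SUCI5.A g1 g2 g3 g4) ξ h ρ ↔
        SUCI5.rhoInf g1 = ρ) := by
  exact ⟨(SUCI5.orderFive hg).locallyAccurate,
    (SUCI5.orderFive hg).locallyAccurate.operatorAccurate (SUCI5.orderFive hg).row_zero,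
    fun ξ h hh ρ => ⟨fun H => (SUCI5.hasHighFreqDoubleEigenvalue hg ξ hh).unique H,
      fun H => H ▸ SUCI5.hasHighFreqDoubleEigenvalue hg ξ hh⟩⟩
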